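/- **Setting.** Let $d\ge 1$ and $s,J\in\mathbb N=\{0,1,2,\dots\}$ with $J<s-d/2$. For an open set $U\subset\mathbb R^d$ let $H_0^s(U)$ be the closure of $C_c^\infty(U)$ in the norm $\big(\sum_{|\gamma|\le s}\|D^\gamma u\|_{L^2(U)}^2\big)^{1/2}$; for $f\in H_0^s(U)$ put $|f|_{H^t(U)}=\big(\sum_{|\gamma|=t}\|D^\gamma f\|_{L^2(U)}^2\big)^{1/2}$, $0\le t\le s$, and $\|f\|_{H^s_0(U)}=|f|_{H^s(U)}$ (equivalent to the full norm when $U$ is bounded). $H^{-s}(U)$ is the dual of $H_0^s(U)$, $[f,\phi]$ is the duality pairing, and for an open $V\subset U$ and $\phi\in H^{-s}(U)$, $$\|\phi\|_{H^{-s}(V)}=\sup_{0\ne v\in H_0^s(V)}\frac{[v,\phi]}{\|v\|_{H_0^s(V)}} .$$ (Functions in $H_0^s(V)$ are extended by zero.) If $\tau$ is not open, $H_0^s(\tau)$ and $H^{-s}(\tau)$ refer to the interior of $\tau$. *Domain and partition.* Let $\Omega\subset\mathbb R^d$ be a bounded domain with Lipschitz boundary, $\delta\in(0,1)$, $h>0$,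 and let $\tau_1,\dots,\tau_Q$ be a partition of $\Omega$ up to boundaries of the cells: $\tau_i\subset\Omega$, the interiors of the $\tau_i$ are pairwise disjoint, $\Omega\subset\bigcup_i\overline{\tau_i}$, and each $\tau_i$ contains the interior of its closure. Suppose that each closure $\overline{\tau_i}$ is convex, contains the ball of center $\mathbf x_i$ and radius $\delta h$, and is contained in the ball of center $\mathbf x_i$ and radius $h/\delta$. *Measurements.* For each $i$ let $\phi_{i,\alpha}\in H^{-s}(\Omega)$, $\alpha\in\mathsf T_i$, be a finite family that is linearly independent when acting on $H_0^s(\tau_i)$ and local, i.e. $[\psi,\phi_{i,\alpha}]=0$ for every $\psi\in C_c^\infty(\Omega\setminus\tau_i)$. Suppose that $$\{h^{d/2}\delta_{\mathbf x_i}\}\subset\{\phi_{i,\alpha}:\alpha\in\mathsf T_i\}\subset\{h^{d/2+|\gamma|}\,\delta_{\mathbf x_i}\circ D^\gamma:\ 0\le|\gamma|\le J\},$$ where $h^{d/2+|\gamma|}\delta_{\mathbf x_i}\circ D^\gamma$ (with $\delta_{\mathbf x}$ the Dirac functional at $\mathbf x$, unrelated to the number $\delta$) is the element of $H^{-s}(\Omega)$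 that maps each $u\in C_c^\infty(\Omega)$ to $h^{d/2+|\gamma|}D^\gamma u(\mathbf x_i)$. Let $\Phi^\perp=\{f\in H_0^s(\Omega):[f,\phi_{i,\alpha}]=0\text{ for all }1\le i\le Q,\ \alpha\in\mathsf T_i\}$. **Proposition.** The functionals $h^{d/2+|\gamma|}\delta_{\mathbf x_i}\circ D^\gamma$, $1\le i\le Q$, $|\gamma|\le J$, are well-defined elements of $H^{-s}(\Omega)$, and there is a constant $C_0>0$ depending only on $\delta,d,s,J$ such that, for all $\Omega$, $h$, $Q$, $\tau_i$, $\mathbf x_i$, $\phi_{i,\alpha}$ as above, the following three conditions hold: 1. $|f|_{H^t(\Omega)}\le C_0h^{s-t}\|f\|_{H_0^s(\Omega)}$ for all integers $0\le t\le s$ and all $f\in\Phi^\perp$; 2. $\displaystyle\sum_{1\le i\le Q,\ \alpha\in\mathsf T_i}[f,\phi_{i,\alpha}]^2\le C_0\sum_{t=0}^sh^{2t}|f|_{H^t(\Omega)}^2$ for all $f\in H_0^s(\Omega)$; 3. $\displaystyle|y|\le C_0h^{-s}\Big\|\sum_{\alpha\in\mathsf T_i}y_\alpha\phi_{i,\alpha}\Big\|_{H^{-s}(\tau_i)}$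 for all $1\le i\le Q$ and $y\in\mathbb R^{\mathsf T_i}$, where $|y|$ is the Euclidean norm. -/

import Mathlib

open MeasureTheory TopologicalSpace
open scoped Distributions LineDeriv ContDiff

noncomputable section

namespace Gamblet

/-- Euclidean space `ℝ^d`. -/
abbrev E (d : ℕ) : Type := EuclideanSpace ℝ (Fin d)

/-! ### Smooth test functions and partial derivatives -/

/-- The partial derivative `D^γ = D_1^{γ_1} ⋯ D_d^{γ_d}` acting on `C_c^∞(U)`. -/
def partialD {d : ℕ} {U : Opens (E d)} (γ : Fin d → ℕ) : 𝓓(U, ℝ) →ₗ[ℝ] 𝓓(U, ℝ) :=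
  ((List.finRange d).map fun k =>
    ((LineDeriv.lineDerivOpCLM ℝ 𝓓(U, ℝ) (EuclideanSpace.single k (1 : ℝ))).toLinearMap :
      Module.End ℝ 𝓓(U, ℝ)) ^ γ k).prod

/-- The multi-indices `γ ∈ ℕ^d` with `|γ| ≤ s`. -/
def multiIdx (d s : ℕ) : Finset (Fin d → ℕ) :=
  (Fintype.piFinset fun _ => Finset.range (s + 1)).filter fun γ => ∑ k, γ k ≤ s

theorem mem_multiIdx {d s : ℕ} {γ : Fin d → ℕ} : γ ∈ multiIdx d s ↔ ∑ k, γ k ≤ s := by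
  simp only [multiIdx, Finset.mem_filter, Fintype.mem_piFinset, Finset.mem_range,
    and_iff_right_iff_imp]
  exact fun h k =>
    Nat.lt_succ_of_le ((Finset.single_le_sum (fun _ _ => Nat.zero_le _) (Finset.mem_univ k)).trans h)

/-! ### The Sobolev space `H_0^s` and its dual `H^{-s}` -/

theorem memLp_test {d : ℕ} {U : Opens (E d)} (u : 𝓓(U, ℝ)) :
    MemLp (u : E d → ℝ) 2 (volume : Measure (E d)) :=
  u.continuous.memLp_of_hasCompactSupport u.hasCompactSupport

/-- A test function, extended by zero, as an element of `L²(ℝ^d)`. -/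
def testToL2 {d : ℕ} (U : Opens (E d)) : 𝓓(U, ℝ) →ₗ[ℝ] Lp ℝ 2 (volume : Measure (E d)) where
  toFun u := (memLp_test u).toLp u
  map_add' u v := MemLp.toLp_add (memLp_test u) (memLp_test v)
  map_smul' c u := MemLp.toLp_const_smul c (memLp_test u)

/-- The Hilbert space `⨁_{|γ| ≤ s} L²(ℝ^d)`, with norm `(∑_{|γ| ≤ s} ‖f_γ‖²)^{1/2}`. A Sobolev
function `f` is represented in it by the family `(D^γ f)_{|γ| ≤ s}` of its weak derivatives. -/
abbrev Jet (d s : ℕ) : Type :=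
  PiLp 2 fun _ : multiIdx d s => Lp ℝ 2 (volume : Measure (E d))

/-- `u ↦ (D^γ u)_{|γ| ≤ s}` for `u ∈ C_c^∞(U)`. -/
def jet {d : ℕ} (s : ℕ) (U : Opens (E d)) : 𝓓(U, ℝ) →ₗ[ℝ] Jet d s :=
  (WithLp.linearEquiv 2 ℝ (multiIdx d s → Lp ℝ 2 (volume : Measure (E d)))).symm.toLinearMap ∘ₗ
    LinearMap.pi fun γ => testToL2 U ∘ₗ partialD γ.1

/-- The Sobolev space `H_0^s(U)`: the closure of `C_c^∞(U)` in the norm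
`(∑_{|γ| ≤ s} ‖D^γ u‖²_{L²})^{1/2}`. Its elements are extended by zero outside `U`; thus
`H_0^s(V) ≤ H_0^s(U)` for `V ≤ U`. -/
def H0 {d : ℕ} (s : ℕ) (U : Opens (E d)) : Submodule ℝ (Jet d s) :=
  (LinearMap.range (jet s U)).topologicalClosure

theorem jet_mem_H0 {d : ℕ} (s : ℕ) (U : Opens (E d)) (u : 𝓓(U, ℝ)) : jet s U u ∈ H0 s U :=
  Submodule.le_topologicalClosure _ ⟨u, rfl⟩

/-- A test function as an element of `H_0^s(U)`. -/
def toH0 {d : ℕ} (s : ℕ) (U : Opens (E d)) (u : 𝓓(U, ℝ)) : H0 s U :=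
  ⟨jet s U u, jet_mem_H0 s U u⟩

/-- The Sobolev seminorm `|f|_{H^t} = (∑_{|γ| = t} ‖D^γ f‖²_{L²})^{1/2}`, for `t ≤ s`. -/
def sobolevSeminorm {d s : ℕ} (t : ℕ) (f : Jet d s) : ℝ :=
  √(∑ γ : multiIdx d s with ∑ k, γ.1 k = t, ‖f γ‖ ^ 2)

/-- The norm of `H_0^s`: `‖f‖_{H_0^s} = |f|_{H^s}`, equivalent on bounded domains to the full norm
by Poincaré's inequality. -/
def h0norm {d s : ℕ} (f : Jet d s) : ℝ := sobolevSeminorm s f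

/-- `H^{-s}(U)`, the space of continuous linear functionals on `H_0^s(U)`. The duality pairing
`[f, φ]` is `φ f`. -/
abbrev Hneg {d : ℕ} (s : ℕ) (U : Opens (E d)) : Type := StrongDual ℝ (H0 s U)

/-- `H_0^s(V)` as a subspace of `H_0^s(U)`, where `V ≤ U`. -/
def H0sub {d : ℕ} (s : ℕ) (U V : Opens (E d)) : Submodule ℝ (H0 s U) :=
  (H0 s V).comap (H0 s U).subtype

/-- `‖φ‖_{H^{-s}(V)} = sup_{v ∈ H_0^s(V)} [v, φ] / ‖v‖_{H_0^s(V)}` for `φ ∈ H^{-s}(U)`, `V ≤ U`.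
The term `v = 0` contributes `0`. -/
def hnegNorm {d s : ℕ} {U : Opens (E d)} (V : Opens (E d)) (φ : Hneg s U) : ℝ :=
  ⨆ v : H0sub s U V, φ v.1 / h0norm v.1.1

/-! ### Domains and partitions -/

/-- `U` is a bounded domain (nonempty connected open set) with Lipschitz boundary: near each
boundary point, `U` is the region strictly above the graph of a Lipschitz function over a
hyperplane, in the direction of a unit normal `n` of the hyperplane. -/
structure IsBoundedLipschitzDomain {d : ℕ} (U : Opens (E d)) : Prop where
  connected : IsConnected (U : Set (E d))
  bounded : Bornology.IsBounded (U : Set (E d))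
  lipschitz : ∀ p ∈ frontier (U : Set (E d)), ∃ n : E d, ‖n‖ = 1 ∧
    ∃ (g : (ℝ ∙ n)ᗮ → ℝ) (K : NNReal), LipschitzWith K g ∧
      ∃ r > 0, ∀ y ∈ Metric.ball p r, y ∈ U ↔ g ((ℝ ∙ n)ᗮ.orthogonalProjectionOnto y) < inner ℝ n y

/-- `τ_1, …, τ_Q` is a partition of the domain `U` (up to boundaries of the cells) into cells with
convex closure such that the closure of `τ_i` contains the ball `B(x_i, δ h)` and is contained in
the ball of centre `x_i` and radius `h / δ`. -/
structure IsCellPartition {d Q : ℕ} (U : Opens (E d)) (δ h : ℝ) (τ : Fin Q → Set (E d))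
    (x : Fin Q → E d) : Prop where
  subset : ∀ i, τ i ⊆ U
  cover : (U : Set (E d)) ⊆ ⋃ i, closure (τ i)
  disjoint : Pairwise fun i j => Disjoint (interior (τ i)) (interior (τ j))
  /-- A cell is an open set together with a part of the boundary of this set; the open set lies
  only on one side of its boundary, as it does for Lipschitz sets. -/
  regular : ∀ i, interior (closure (τ i)) ⊆ τ i
  /-- With the two conditions on balls, convexity makes the closures uniformly Lipschitz. -/
  convex : ∀ i, Convex ℝ (closure (τ i))
  ball_subset : ∀ i, Metric.ball (x i) (δ * h) ⊆ closure (τ i)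
  subset_ball : ∀ i, closure (τ i) ⊆ Metric.closedBall (x i) (h / δ)

/-! ### Measurement functionals -/

/-- The standing assumptions on measurement functionals `φ_{i,α} ∈ H^{-s}(U)`. -/
structure IsMeasurementFamily {d s Q : ℕ} {U : Opens (E d)} (τ : Fin Q → Set (E d))
    {T : Fin Q → Type} (φ : ∀ i, T i → Hneg s U) : Prop where
  /-- `φ_{i,α}`, `α ∈ T_i`, are linearly independent as functionals on `H_0^s(τ_i)`. -/
  linearIndependent : ∀ i, LinearIndependent ℝ fun α : T i =>
    (φ i α).toLinearMap.domRestrict (H0sub s U (Opens.interior (τ i)))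
  /-- `[φ_{i,α}, ψ] = 0` for all `ψ ∈ C_c^∞(U ∖ τ_i)`. -/
  locality : ∀ i (α : T i) (ψ : 𝓓(U, ℝ)), Disjoint (tsupport ψ) (τ i) → φ i α (toH0 s U ψ) = 0

/-- `φ ∈ H^{-s}(U)` is the functional `h^{d/2 + |γ|} δ_p ∘ D^γ`. Since `C_c^∞(U)` is dense in
`H_0^s(U)`, there is at most one such `φ`. -/
def IsScaledDerivDirac {d s : ℕ} {U : Opens (E d)} (h : ℝ) (p : E d) (γ : Fin d → ℕ)
    (φ : Hneg s U) : Prop :=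
  ∀ u : 𝓓(U, ℝ), φ (toH0 s U u) = h ^ ((d : ℝ) / 2 + ∑ k, (γ k : ℝ)) * partialD γ u p

/-! ### The three conditions -/

section Conditions

variable {d s Q : ℕ} {U : Opens (E d)} {T : Fin Q → Type}

/-- `Φ^⊥ = {f ∈ H_0^s(U) : [f, φ_{i,α}] = 0 for all i, α}`. -/
def PhiPerp (φ : ∀ i, T i → Hneg s U) : Set (H0 s U) := {f | ∀ i α, φ i α f = 0}

/-- `|f|_{H^t(U)} ≤ C h^{s-t} ‖f‖_{H_0^s(U)}` for all `0 ≤ t ≤ s` and `f ∈ Φ^⊥`. -/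
def PoincareCondition (C h : ℝ) (φ : ∀ i, T i → Hneg s U) : Prop :=
  ∀ t ≤ s, ∀ f ∈ PhiPerp φ, sobolevSeminorm t f.1 ≤ C * h ^ (s - t) * h0norm f.1

/-- `∑_{i,α} [f, φ_{i,α}]² ≤ C ∑_{t=0}^s h^{2t} |f|²_{H^t(U)}` for all `f ∈ H_0^s(U)`. -/
def UpperBoundCondition [∀ i, Fintype (T i)] (C h : ℝ) (φ : ∀ i, T i → Hneg s U) : Prop :=
  ∀ f : H0 s U,
    ∑ i, ∑ α, φ i α f ^ 2 ≤ C * ∑ t ∈ Finset.range (s + 1), h ^ (2 * t) * sobolevSeminorm t f.1 ^ 2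

/-- `|y| ≤ C h^{-s} ‖∑_α y_α φ_{i,α}‖_{H^{-s}(τ_i)}` for all `i` and `y ∈ ℝ^{T_i}`. -/
def LowerBoundCondition [∀ i, Fintype (T i)] (C h : ℝ) (τ : Fin Q → Set (E d))
    (φ : ∀ i, T i → Hneg s U) : Prop :=
  ∀ i (y : EuclideanSpace ℝ (T i)),
    ‖y‖ ≤ C * (h ^ s)⁻¹ * hnegNorm (Opens.interior (τ i)) (∑ α, y α • φ i α)

end Conditions

end Gamblet

end

noncomputable section

namespace Gamblet

variable {d : ℕ} {U V : Opens (E d)}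

/-! ### Calculus of test functions -/

/-! The first two conditions are estimates for test functions that pass to `H0` by density. Both
rest on one inequality on a ball `B` of radius `R` about `p`, valid for `s > d / 2`
(`exists_lintegral_sub_center_le`): `∫_B |u - u(p)|² ≤ C ∑_{1 ≤ k ≤ s} R^{2k} |u|²_{H^k(B)}`. To
prove it, expand `u` along the segment from `p` to `x` about the far end `x`, not about `p`: the
Taylor terms are then derivatives at `x`, which integrate to energies. The remainder is an integral
over the points `p + t(x - p)`. Cauchy–Schwarz distributes its weight so that a factor `t^d` pays
for the Jacobian of the dilation, and what is left is `t^{s-1-d/2}`, integrable on `(0,1]` because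
`s > d / 2`.

Upper bound: the inequality controls `u(p)`, hence also `D^γ u(p)` as long as `s - |γ| > d / 2`.
Summing over the balls of radius `h / δ` about the `x_i` costs only a constant, since disjointness
of the balls of radius `δ h` limits the overlap (`exists_boundedOverlap`).

Poincaré: the balls of radius `h / δ` cover the domain, so `‖u‖²` is bounded by the samples and the
energies of orders `1, …, s`. Integration by parts, free of boundary terms, makes the energies
log-convex in the order up to constants; interpolation then trades intermediate orders for a small
multiple of order `0`, which is absorbed, and a multiple of order `s` (`exists_testEnergy_le`). On
`PhiPerp` the samples vanish.

Lower bound: cut-off monomials rescaled to the ball of radius `δ h` are biorthogonal to the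
functionals and have `H_0^s` norm of order `h^{-s}` (`exists_dual_test`). Pairing with their
combination with coefficients `y` gives `|y|²` and bounds the dual norm from below. Friedrichs'
inequality ensures that the supremum defining this norm is finite. -/

/-- The directional derivative `∂_v` as an endomorphism of `C_c^∞(U)`. -/
def lineD (v : E d) : Module.End ℝ 𝓓(U, ℝ) :=
  (LineDeriv.lineDerivOpCLM ℝ 𝓓(U, ℝ) v).toLinearMap

theorem lineD_apply (v : E d) (u : 𝓓(U, ℝ)) (x : E d) : lineD v u x = fderiv ℝ u x v := by
  change TestFunction.lineDerivCLM ℝ v u x = _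
  rw [TestFunction.lineDerivCLM_eq_fderivCLM, TestFunction.fderivCLM_apply_of_le u (by simp)]

theorem coe_lineD (v : E d) (u : 𝓓(U, ℝ)) :
    (lineD v u : E d → ℝ) = fun x => fderiv ℝ u x v :=
  funext (lineD_apply v u)

theorem contDiff_test (u : 𝓓(U, ℝ)) : ContDiff ℝ ∞ (u : E d → ℝ) := u.contDiff

theorem differentiable_test (u : 𝓓(U, ℝ)) : Differentiable ℝ (u : E d → ℝ) :=
  (contDiff_test u).differentiable (by simp)

theorem two_le_infty : (2 : ℕ∞ω) ≤ ∞ := WithTop.coe_le_coe.2 (le_top : (2 : ℕ∞) ≤ ⊤)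

/-- Symmetry of the second derivative. As `partialD` is an ordered product, additivity in the
multi-index depends on this. -/
theorem commute_lineD (v w : E d) : Commute (lineD v : Module.End ℝ 𝓓(U, ℝ)) (lineD w) := by
  refine LinearMap.ext fun u => TestFunction.ext fun x => ?_
  have h2 : DifferentiableAt ℝ (fderiv ℝ (u : E d → ℝ)) x :=
    (((contDiff_test u).fderiv_right (m := 1)
      (one_add_one_eq_two.trans_le two_le_infty)).differentiable one_ne_zero).differentiableAt
  have key : ∀ a b : E d, lineD a (lineD b u) x = fderiv ℝ (fderiv ℝ u) x a b := fun a b => by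
    rw [lineD_apply, coe_lineD]
    rw [fderiv_clm_apply h2 (differentiableAt_const b)]
    simp
  have hs : IsSymmSndFDerivAt ℝ (u : E d → ℝ) x :=
    (contDiff_test u).contDiffAt.isSymmSndFDerivAt
      (by simpa using two_le_infty)
  change lineD v (lineD w u) x = lineD w (lineD v u) x
  rw [key, key, hs.eq]

theorem partialD_def (γ : Fin d → ℕ) :
    (partialD γ : Module.End ℝ 𝓓(U, ℝ)) =
      ((List.finRange d).map fun k => lineD (EuclideanSpace.single k (1 : ℝ)) ^ γ k).prod := rfl

theorem list_prod_map_mul_of_commute {ι M : Type*} [Monoid M] (L : List ι) (f g : ι → M)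
    (h : ∀ i j, Commute (f i) (g j)) :
    (L.map fun i => f i * g i).prod = (L.map f).prod * (L.map g).prod := by
  induction L with
  | nil => simp
  | cons a L ih =>
    simp only [List.map_cons, List.prod_cons, ih]
    have : Commute (g a) (L.map f).prod := by
      refine Commute.list_prod_right _ _ fun x hx => ?_
      obtain ⟨i, -, rfl⟩ := List.mem_map.1 hx
      exact (h i a).symm
    simp only [mul_assoc]
    rw [← mul_assoc (g a), this.eq, mul_assoc]

theorem partialD_zero : (partialD 0 : Module.End ℝ 𝓓(U, ℝ)) = 1 := by
  simp [partialD_def]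

theorem partialD_add (γ γ' : Fin d → ℕ) :
    (partialD (γ + γ') : Module.End ℝ 𝓓(U, ℝ)) = partialD γ * partialD γ' := by
  simp only [partialD_def, Pi.add_apply, pow_add]
  exact list_prod_map_mul_of_commute _ _ _ fun i j => (commute_lineD _ _).pow_pow _ _

theorem partialD_single (k : Fin d) :
    (partialD (Pi.single k 1) : Module.End ℝ 𝓓(U, ℝ)) = lineD (EuclideanSpace.single k 1) := by
  rw [partialD_def, List.prod_map_eq_pow_single k
    (f := fun j => lineD (EuclideanSpace.single j (1 : ℝ)) ^ (Pi.single k 1 : Fin d → ℕ) j)]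
  · simp [List.count_eq_one_of_mem (List.nodup_finRange d) (List.mem_finRange k)]
  · intro j hj _
    simp [hj]

theorem partialD_single_add (γ : Fin d → ℕ) (k : Fin d) (u : 𝓓(U, ℝ)) :
    partialD (Pi.single k 1 + γ) u = lineD (EuclideanSpace.single k 1) (partialD γ u) := by
  rw [partialD_add, partialD_single]; rfl

theorem lineD_eq_sum (v : E d) :
    (lineD v : Module.End ℝ 𝓓(U, ℝ)) = ∑ k, v k • lineD (EuclideanSpace.single k 1) := by
  refine LinearMap.ext fun u => TestFunction.ext fun x => ?_
  have hv : v = ∑ k, v k • EuclideanSpace.single k (1 : ℝ) := by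
    ext j; simp [Finset.sum_apply, Pi.single_apply]
  have h1 : ∀ (s : Finset (Fin d)), (∑ k ∈ s, v k • lineD (EuclideanSpace.single k 1) u : 𝓓(U, ℝ)) x
      = ∑ k ∈ s, v k * lineD (EuclideanSpace.single k 1) u x := fun s => by
    induction s using Finset.induction_on with
    | empty => simp
    | insert a s ha ih => rw [Finset.sum_insert ha, Finset.sum_insert ha, ← ih]; rfl
  simp only [LinearMap.sum_apply, LinearMap.smul_apply]
  rw [h1]
  simp only [lineD_apply]
  conv_lhs => rw [hv]
  simp

/-- The multi-indices `γ` with `|γ| = t`. -/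
def level (d t : ℕ) : Finset (Fin d → ℕ) := Finset.piAntidiag Finset.univ t

theorem mem_level {t : ℕ} {γ : Fin d → ℕ} : γ ∈ level d t ↔ ∑ k, γ k = t := by
  simp [level]

/-- The step of every induction on `|γ|` below. -/
theorem exists_eq_single_add {t : ℕ} {γ : Fin d → ℕ} (hγ : ∑ k, γ k = t + 1) :
    ∃ (i : Fin d) (γ' : Fin d → ℕ), γ = Pi.single i 1 + γ' ∧ ∑ k, γ' k = t := by
  obtain ⟨i, hi⟩ : ∃ i, γ i ≠ 0 := by
    by_contra! h
    simp [h] at hγ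
  have hsplit : γ = Pi.single i 1 + (γ - Pi.single i 1) := by
    ext j
    rcases eq_or_ne j i with rfl | hj
    · simp; omega
    · simp [hj]
  refine ⟨i, γ - Pi.single i 1, hsplit, ?_⟩
  rw [hsplit] at hγ
  simp only [Pi.add_apply, Finset.sum_add_distrib, Finset.sum_pi_single', Finset.mem_univ,
    if_true] at hγ
  omega

/-- Translation by `γ` embeds one level injectively into another. The values of `F` are kept general
because both real and `ENNReal` sums occur. -/
theorem sum_level_partialD_le (t : ℕ) (γ : Fin d → ℕ) (u : 𝓓(U, ℝ)) {R : Type*}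
    [AddCommMonoid R] [PartialOrder R] [IsOrderedAddMonoid R] (F : 𝓓(U, ℝ) → R)
    (hF : ∀ w, 0 ≤ F w) :
    ∑ γ' ∈ level d t, F (partialD γ' (partialD γ u)) ≤
      ∑ γ' ∈ level d (t + ∑ k, γ k), F (partialD γ' u) := by
  classical
  calc ∑ γ' ∈ level d t, F (partialD γ' (partialD γ u))
      = ∑ γ' ∈ (level d t).map (addRightEmbedding γ), F (partialD γ' u) := by
        rw [Finset.sum_map]
        refine Finset.sum_congr rfl fun γ' _ => ?_
        simp only [addRightEmbedding_apply, partialD_add]; rfl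
    _ ≤ _ := by
        refine Finset.sum_le_sum_of_subset_of_nonneg ?_ fun _ _ _ => hF _
        intro η hη
        obtain ⟨γ', h', rfl⟩ := Finset.mem_map.1 hη
        rw [mem_level] at *
        simp [Finset.sum_add_distrib, h']

/-- Expand one factor `∂_y` at a time in coordinates: there are `d` terms, each with coefficient at
most `‖y‖`. -/
theorem abs_lineD_pow_le (k : ℕ) (y : E d) (u : 𝓓(U, ℝ)) (x : E d) :
    |(lineD y ^ k : Module.End ℝ 𝓓(U, ℝ)) u x| ≤
      (d * ‖y‖) ^ k * ∑ γ ∈ level d k, |partialD γ u x| := by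
  induction k generalizing u with
  | zero =>
    have : (0 : Fin d → ℕ) ∈ level d 0 := by simp [mem_level]
    have h := Finset.single_le_sum (f := fun γ => |partialD γ u x|)
      (fun _ _ => abs_nonneg _) this
    simpa [partialD_zero] using h
  | succ k ih =>
    have hexp : (lineD y ^ (k + 1) : Module.End ℝ 𝓓(U, ℝ)) u x =
        ∑ i, y i *
          (lineD y ^ k : Module.End ℝ 𝓓(U, ℝ)) (lineD (EuclideanSpace.single i 1) u) x := by
      have hev : ∀ (s : Finset (Fin d)) (f : Fin d → 𝓓(U, ℝ)),
          (∑ i ∈ s, y i • f i) x = ∑ i ∈ s, y i * f i x := fun s f => by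
        induction s using Finset.induction_on with
        | empty => simp
        | insert a s ha ih => rw [Finset.sum_insert ha, Finset.sum_insert ha, ← ih]; rfl
      have : (lineD y ^ (k + 1) : Module.End ℝ 𝓓(U, ℝ)) u = ∑ i, y i •
          (lineD y ^ k : Module.End ℝ 𝓓(U, ℝ)) (lineD (EuclideanSpace.single i 1) u) := by
        rw [pow_succ, Module.End.mul_apply]
        have h1 := LinearMap.congr_fun (lineD_eq_sum (U := U) y) u
        rw [LinearMap.sum_apply] at h1
        rw [h1, map_sum]
        exact Finset.sum_congr rfl fun i _ => LinearMap.map_smul _ _ _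
      rw [this, hev]
    rw [hexp]
    have hb : ∀ i ∈ Finset.univ, |y i * (lineD y ^ k : Module.End ℝ 𝓓(U, ℝ))
        (lineD (EuclideanSpace.single i 1) u) x| ≤
        ‖y‖ * ((d * ‖y‖) ^ k * ∑ γ ∈ level d (k + 1), |partialD γ u x|) := fun i _ => by
      rw [abs_mul]
      refine mul_le_mul (PiLp.norm_apply_le y i) ((ih _).trans ?_) (abs_nonneg _) (norm_nonneg _)
      refine mul_le_mul_of_nonneg_left ?_ (by positivity)
      have := sum_level_partialD_le k (Pi.single i 1) u (fun w => |w x|) fun _ => abs_nonneg _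
      simpa [partialD_single] using this
    refine (Finset.abs_sum_le_sum_abs _ _).trans ((Finset.sum_le_sum hb).trans (le_of_eq ?_))
    simp; ring

theorem hasDerivAt_test_line (u : 𝓓(U, ℝ)) (p y : E d) (t : ℝ) :
    HasDerivAt (fun t : ℝ => u (p + t • y)) (lineD y u (p + t • y)) t := by
  rw [lineD_apply]
  have h1 : HasDerivAt (fun t : ℝ => p + t • y) y t := by
    simpa using ((hasDerivAt_id t).smul_const y).const_add p
  exact ((differentiable_test u).differentiableAt.hasFDerivAt).comp_hasDerivAt t h1

theorem integrable_test_mul (u w : 𝓓(U, ℝ)) : Integrable (fun x => u x * w x) :=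
  (u.continuous.mul w.continuous).integrable_of_hasCompactSupport u.hasCompactSupport.mul_right

theorem integral_test_mul_lineD (v : E d) (u w : 𝓓(U, ℝ)) :
    ∫ x, u x * lineD v w x = -∫ x, lineD v u x * w x := by
  refine integral_bilinear_hasLineDerivAt_right_eq_neg_left_of_integrable (v := v)
    (B := ContinuousLinearMap.mul ℝ ℝ) (integrable_test_mul _ _) (integrable_test_mul _ _)
    (integrable_test_mul _ _) ?_ ?_ <;>
  · intro x _
    rw [lineD_apply]
    exact ((differentiable_test _).differentiableAt.hasFDerivAt).hasLineDerivAt v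

theorem ennreal_add_sq_le (a b : ENNReal) : (a + b) ^ 2 ≤ 2 * (a ^ 2 + b ^ 2) := by
  have := ENNReal.rpow_add_le_mul_rpow_add_rpow a b (one_le_two : (1 : ℝ) ≤ 2)
  norm_num at this
  simpa using this

theorem ennreal_sq_sum_le {ι : Type*} (s : Finset ι) (f : ι → ENNReal) :
    (∑ i ∈ s, f i) ^ 2 ≤ s.card * ∑ i ∈ s, f i ^ 2 := by
  have := ENNReal.rpow_sum_le_const_mul_sum_rpow s f (one_le_two : (1 : ℝ) ≤ 2)
  norm_num at this
  simpa using this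

/-! ### One-dimensional Taylor estimate -/

/-- Taylor's formula about the endpoint `1`, by repeated integration by parts. The kernel `t ^ s /
s!` vanishes at `0`, so no derivative at `0` enters, and its primitive is at most `1` at the
endpoint `1`. -/
theorem abs_sub_le_taylor (g : ℕ → ℝ → ℝ) (hg : ∀ k t, HasDerivAt (g k) (g (k + 1) t) t) (s : ℕ) :
    |g 0 1 - g 0 0| ≤ ∑ k ∈ Finset.Ico 1 (s + 1), |g k 1| +
      |∫ t in (0 : ℝ)..1, t ^ s / s.factorial * g (s + 1) t| := by
  have hc : ∀ k, Continuous (g k) := fun k =>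
    continuous_iff_continuousAt.2 fun t => (hg k t).continuousAt
  induction s with
  | zero =>
    have := intervalIntegral.integral_eq_sub_of_hasDerivAt (a := 0) (b := 1) (fun t _ => hg 0 t)
      ((hc 1).intervalIntegrable _ _)
    simp [this]
  | succ s ih =>
    refine ih.trans ?_
    rw [Finset.sum_Ico_succ_top (Nat.le_add_left 1 s), add_assoc]
    gcongr
    have hd : ∀ t : ℝ, HasDerivAt (fun t : ℝ => t ^ (s + 1) / (s + 1).factorial)
        (t ^ s / s.factorial) t := fun t => by
      have := (hasDerivAt_pow (s + 1) t).div_const ((s + 1).factorial : ℝ)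
      refine this.congr_deriv ?_
      rw [Nat.factorial_succ]
      push_cast
      have : (s.factorial : ℝ) ≠ 0 := by positivity
      field_simp
    have := intervalIntegral.integral_mul_deriv_eq_deriv_mul (a := 0) (b := 1)
      (u := fun t : ℝ => t ^ (s + 1) / (s + 1).factorial) (v := g (s + 1))
      (fun t _ => hd t) (fun t _ => hg (s + 1) t)
      ((by fun_prop : Continuous fun t : ℝ => t ^ s / (s.factorial : ℝ)).intervalIntegrable _ _)
      ((hc _).intervalIntegrable _ _)
    rw [eq_sub_iff_add_eq, ← eq_sub_iff_add_eq'] at this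
    rw [this]
    simp only [one_pow, ne_eq, Nat.add_eq_zero_iff, one_ne_zero, and_false, not_false_eq_true,
      zero_pow, zero_div, zero_mul, sub_zero]
    refine (abs_sub _ _).trans (add_le_add ?_ le_rfl)
    rw [abs_mul]
    refine mul_le_of_le_one_left (abs_nonneg _) ?_
    rw [abs_of_nonneg (by positivity), div_le_one (by positivity)]
    exact_mod_cast Nat.one_le_iff_ne_zero.2 (Nat.factorial_ne_zero _)

theorem enorm_sub_le_taylor (g : ℕ → ℝ → ℝ) (hg : ∀ k t, HasDerivAt (g k) (g (k + 1) t) t)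
    (s : ℕ) :
    ‖g 0 1 - g 0 0‖ₑ ≤ ∑ k ∈ Finset.Ico 1 (s + 1), ‖g k 1‖ₑ +
      ∫⁻ t in Set.Ioc (0 : ℝ) 1, ENNReal.ofReal t ^ s * ‖g (s + 1) t‖ₑ := by
  have h := ENNReal.ofReal_le_ofReal (abs_sub_le_taylor g hg s)
  rw [ENNReal.ofReal_add (Finset.sum_nonneg fun _ _ => abs_nonneg _) (abs_nonneg _),
    ENNReal.ofReal_sum_of_nonneg fun _ _ => abs_nonneg _] at h
  simp only [← Real.enorm_eq_ofReal_abs] at h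
  refine h.trans ?_
  gcongr
  rw [intervalIntegral.integral_of_le zero_le_one]
  refine (enorm_integral_le_lintegral_enorm _).trans ?_
  refine setLIntegral_mono' measurableSet_Ioc fun t ht => ?_
  rw [enorm_mul]
  gcongr
  rw [Real.enorm_eq_ofReal (div_nonneg (pow_nonneg ht.1.le _) (by positivity)),
    ← ENNReal.ofReal_pow ht.1.le]
  refine ENNReal.ofReal_le_ofReal (div_le_self (pow_nonneg ht.1.le _) ?_)
  exact_mod_cast Nat.one_le_iff_ne_zero.2 (Nat.factorial_ne_zero _)

/-- The Cauchy–Schwarz inequality for the splitting `t ^ s = t ^ (m / 2) * t ^ ((m + d) / 2)`,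
`m = s - d / 2`. -/
theorem sq_lintegral_pow_mul_le (s d : ℕ) (G : ℝ → ENNReal) (hG : Measurable G) :
    (∫⁻ t in Set.Ioc (0 : ℝ) 1, ENNReal.ofReal t ^ s * G t) ^ 2 ≤
      (∫⁻ t in Set.Ioc (0 : ℝ) 1, ENNReal.ofReal (t ^ ((s : ℝ) - d / 2))) *
      ∫⁻ t in Set.Ioc (0 : ℝ) 1, ENNReal.ofReal (t ^ ((s : ℝ) - d / 2)) *
        ENNReal.ofReal t ^ d * G t ^ 2 := by
  set m : ℝ := s - d / 2 with hm
  have hCS := ENNReal.lintegral_mul_le_Lp_mul_Lq (volume.restrict (Set.Ioc (0 : ℝ) 1))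
    (Real.HolderConjugate.two_two) (f := fun t => ENNReal.ofReal (t ^ (m / 2)))
    (g := fun t => ENNReal.ofReal (t ^ ((m + d) / 2)) * G t)
    (by fun_prop) (by fun_prop)
  have e1 : ∫⁻ t in Set.Ioc (0 : ℝ) 1, ENNReal.ofReal t ^ s * G t =
      ∫⁻ t in Set.Ioc (0 : ℝ) 1, ((fun t => ENNReal.ofReal (t ^ (m / 2))) *
        fun t => ENNReal.ofReal (t ^ ((m + d) / 2)) * G t) t := by
    refine setLIntegral_congr_fun measurableSet_Ioc fun t ht => ?_
    simp only [Pi.mul_apply]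
    rw [← mul_assoc, ← ENNReal.ofReal_mul (Real.rpow_nonneg ht.1.le _), ← Real.rpow_add ht.1,
      ← ENNReal.ofReal_pow ht.1.le, ← Real.rpow_natCast]
    congr 3
    rw [hm]; ring
  have e2 : ∫⁻ t in Set.Ioc (0 : ℝ) 1, ENNReal.ofReal (t ^ (m / 2)) ^ (2 : ℝ) =
      ∫⁻ t in Set.Ioc (0 : ℝ) 1, ENNReal.ofReal (t ^ m) := by
    refine setLIntegral_congr_fun measurableSet_Ioc fun t ht => ?_
    rw [ENNReal.ofReal_rpow_of_nonneg (Real.rpow_nonneg ht.1.le _) zero_le_two,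
      ← Real.rpow_mul ht.1.le,
      div_mul_cancel₀ _ two_ne_zero]
  have e3 : ∫⁻ t in Set.Ioc (0 : ℝ) 1, (ENNReal.ofReal (t ^ ((m + d) / 2)) * G t) ^ (2 : ℝ) =
      ∫⁻ t in Set.Ioc (0 : ℝ) 1, ENNReal.ofReal (t ^ m) * ENNReal.ofReal t ^ d * G t ^ 2 := by
    refine setLIntegral_congr_fun measurableSet_Ioc fun t ht => ?_
    rw [ENNReal.mul_rpow_of_nonneg _ _ zero_le_two,
      ENNReal.ofReal_rpow_of_nonneg (Real.rpow_nonneg ht.1.le _) zero_le_two,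
      ← Real.rpow_mul ht.1.le,
      div_mul_cancel₀ _ two_ne_zero, Real.rpow_add ht.1,
      ENNReal.ofReal_mul (Real.rpow_nonneg ht.1.le _),
      Real.rpow_natCast, ENNReal.ofReal_pow ht.1.le]
    simp
  rw [← e1, e2, e3] at hCS
  refine (pow_le_pow_left' hCS 2).trans (le_of_eq ?_)
  rw [mul_pow, ← ENNReal.rpow_natCast, ← ENNReal.rpow_natCast, ← ENNReal.rpow_mul,
    ← ENNReal.rpow_mul]
  norm_num

theorem lintegral_Ioc_rpow_ne_top {m : ℝ} (hm : -1 < m) :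
    ∫⁻ t in Set.Ioc (0 : ℝ) 1, ENNReal.ofReal (t ^ m) ≠ ⊤ := by
  have h : IntegrableOn (fun t : ℝ => t ^ m) (Set.Ioc 0 1) :=
    (intervalIntegrable_iff_integrableOn_Ioc_of_le zero_le_one).1
      (intervalIntegral.intervalIntegrable_rpow' hm)
  exact h.lintegral_lt_top.ne

/-! ### Integrals over balls -/

theorem setLIntegral_closedBall_eq (p : E d) (R : ℝ) (F : E d → ENNReal) :
    ∫⁻ x in Metric.closedBall p R, F x = ∫⁻ w in Metric.closedBall 0 R, F (p + w) := by
  rw [← lintegral_indicator measurableSet_closedBall,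
    ← lintegral_indicator measurableSet_closedBall,
    ← lintegral_add_left_eq_self _ p]
  refine lintegral_congr fun w => ?_
  simp [Set.indicator]

/-- A dilation with factor `t ≤ 1` maps the ball into itself and has Jacobian `t ^ d`. -/
theorem setLIntegral_closedBall_smul_le {t : ℝ} (ht : t ∈ Set.Ioc (0 : ℝ) 1) (R : ℝ)
    (F : E d → ENNReal) (hF : Measurable F) :
    ENNReal.ofReal t ^ d * ∫⁻ w in Metric.closedBall 0 R, F (t • w) ≤
      ∫⁻ w in Metric.closedBall 0 R, F w := by
  rw [← lintegral_indicator measurableSet_closedBall,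
    ← lintegral_indicator measurableSet_closedBall]
  set H := (Metric.closedBall (0 : E d) R).indicator F with hH
  have hHm : Measurable H := hF.indicator measurableSet_closedBall
  have h1 : ∫⁻ w, H (t • w) = ENNReal.ofReal (t ^ d)⁻¹ * ∫⁻ w, H w := by
    rw [← lintegral_map hHm (measurable_const_smul t), Measure.map_addHaar_smul _ ht.1.ne',
      lintegral_smul_measure]
    simp [abs_of_pos ht.1]
  have h2 : ∫⁻ w, (Metric.closedBall (0 : E d) R).indicator (fun w => F (t • w)) w ≤
      ∫⁻ w, H (t • w) := by
    refine lintegral_mono fun w => ?_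
    by_cases hw : w ∈ Metric.closedBall (0 : E d) R
    · have : t • w ∈ Metric.closedBall (0 : E d) R := by
        simp only [mem_closedBall_zero_iff, norm_smul, Real.norm_eq_abs, abs_of_pos ht.1] at hw ⊢
        exact (mul_le_of_le_one_left (norm_nonneg _) ht.2).trans hw
      simp [hH, hw, this]
    · simp [hw]
  calc _ ≤ ENNReal.ofReal t ^ d * (ENNReal.ofReal (t ^ d)⁻¹ * ∫⁻ w, H w) := by
        rw [← h1]; gcongr
    _ = _ := by
        rw [← mul_assoc, ← ENNReal.ofReal_pow ht.1.le, ← ENNReal.ofReal_mul (pow_nonneg ht.1.le _),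
          mul_inv_cancel₀ (pow_pos ht.1 _).ne']
        simp

/-- The energy `∑_{|γ| = t} ∫_B |D^γ u|²`. -/
def energy (t : ℕ) (u : 𝓓(U, ℝ)) (B : Set (E d)) : ENNReal :=
  ∑ γ ∈ level d t, ∫⁻ x in B, ‖partialD γ u x‖ₑ ^ 2

theorem enorm_lineD_pow_sq_le (k : ℕ) {R : ℝ} {y : E d} (hy : ‖y‖ ≤ R) (u : 𝓓(U, ℝ)) (x : E d) :
    ‖(lineD y ^ k : Module.End ℝ 𝓓(U, ℝ)) u x‖ₑ ^ 2 ≤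
      (d ^ (2 * k) * (level d k).card) * ENNReal.ofReal R ^ (2 * k) *
        ∑ γ ∈ level d k, ‖partialD γ u x‖ₑ ^ 2 := by
  have hR : 0 ≤ R := (norm_nonneg y).trans hy
  have h := ENNReal.ofReal_le_ofReal ((abs_lineD_pow_le k y u x).trans
    (mul_le_mul_of_nonneg_right (pow_le_pow_left₀ (by positivity)
      (mul_le_mul_of_nonneg_left hy (Nat.cast_nonneg d)) k)
      (Finset.sum_nonneg fun _ _ => abs_nonneg _)))
  rw [ENNReal.ofReal_mul (by positivity), ENNReal.ofReal_sum_of_nonneg fun _ _ => abs_nonneg _,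
    ENNReal.ofReal_pow (by positivity), ENNReal.ofReal_mul (by positivity),
    ENNReal.ofReal_natCast] at h
  simp only [← Real.enorm_eq_ofReal_abs] at h
  calc _ ≤ ((d * ENNReal.ofReal R) ^ k * ∑ γ ∈ level d k, ‖partialD γ u x‖ₑ) ^ 2 :=
        pow_le_pow_left' h 2
    _ ≤ ((d * ENNReal.ofReal R) ^ k) ^ 2 *
          ((level d k).card * ∑ γ ∈ level d k, ‖partialD γ u x‖ₑ ^ 2) := by
        rw [mul_pow]; gcongr; exact ennreal_sq_sum_le _ _
    _ = _ := by rw [← pow_mul, mul_pow, mul_comm k 2]; ring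

theorem measurable_enorm_test (u : 𝓓(U, ℝ)) : Measurable fun x => ‖u x‖ₑ ^ 2 :=
  (u.continuous.measurable.enorm.pow_const 2)

theorem energy_eq (t : ℕ) (u : 𝓓(U, ℝ)) (B : Set (E d)) :
    energy t u B = ∫⁻ x in B, ∑ γ ∈ level d t, ‖partialD γ u x‖ₑ ^ 2 :=
  (lintegral_finsetSum _ fun _ _ => measurable_enorm_test _).symm

/-- Taylor's formula for `t ↦ u (p + t • w)`, whose `k`-th derivative is `∂_w^k u`, followed by
Cauchy–Schwarz in the sum and in the remainder. -/
theorem enorm_sub_sq_le_taylor (n : ℕ) (u : 𝓓(U, ℝ)) (p w : E d) {R : ℝ} (hw : ‖w‖ ≤ R) :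
    ‖u (p + w) - u p‖ₑ ^ 2 ≤
      2 * (n * ∑ k ∈ Finset.Ico 1 (n + 1), (d ^ (2 * k) * (level d k).card) *
          ENNReal.ofReal R ^ (2 * k) * ∑ γ ∈ level d k, ‖partialD γ u (p + w)‖ₑ ^ 2 +
        (∫⁻ t in Set.Ioc (0 : ℝ) 1, ENNReal.ofReal (t ^ ((n : ℝ) - d / 2))) *
        ∫⁻ t in Set.Ioc (0 : ℝ) 1, ENNReal.ofReal (t ^ ((n : ℝ) - d / 2)) * ENNReal.ofReal t ^ d *
          ((d ^ (2 * (n + 1)) * (level d (n + 1)).card) * ENNReal.ofReal R ^ (2 * (n + 1)) *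
            ∑ γ ∈ level d (n + 1), ‖partialD γ u (p + t • w)‖ₑ ^ 2)) := by
  set g : ℕ → ℝ → ℝ := fun k t => (lineD w ^ k : Module.End ℝ 𝓓(U, ℝ)) u (p + t • w) with hg
  have hd : ∀ k t, HasDerivAt (g k) (g (k + 1) t) t := fun k t => by
    simp only [hg, pow_succ', Module.End.mul_apply]
    exact hasDerivAt_test_line _ p w t
  have h := enorm_sub_le_taylor g hd n
  have h01 : g 0 1 - g 0 0 = u (p + w) - u p := by simp [hg]
  rw [h01] at h
  refine (pow_le_pow_left' h 2).trans ((ennreal_add_sq_le _ _).trans ?_)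
  have hgm : Measurable fun t => ‖g (n + 1) t‖ₑ :=
    (continuous_iff_continuousAt.2 fun t => (hd (n + 1) t).continuousAt).measurable.enorm
  gcongr
  · refine (ennreal_sq_sum_le _ _).trans ?_
    rw [Nat.card_Ico, Nat.add_sub_cancel]
    gcongr with k hk
    simpa [hg] using enorm_lineD_pow_sq_le k hw u (p + (1 : ℝ) • w)
  · refine (sq_lintegral_pow_mul_le n d _ hgm).trans ?_
    gcongr with t
    exact enorm_lineD_pow_sq_le (n + 1) hw u _

/-- Tonelli: for fixed `t` the factor `t ^ d` compensates the dilation, so only the integral of `t ^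
m` remains. -/
theorem lintegral_lintegral_line_le (m : ℝ) (R : ℝ) (F : E d → ENNReal) (hF : Measurable F)
    (p : E d) :
    ∫⁻ w in Metric.closedBall 0 R, ∫⁻ t in Set.Ioc (0 : ℝ) 1,
        ENNReal.ofReal (t ^ m) * ENNReal.ofReal t ^ d * F (p + t • w) ≤
      (∫⁻ t in Set.Ioc (0 : ℝ) 1, ENNReal.ofReal (t ^ m)) * ∫⁻ x in Metric.closedBall p R, F x := by
  have hmeas : Measurable fun q : E d × ℝ => ENNReal.ofReal (q.2 ^ m) * ENNReal.ofReal q.2 ^ d *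
      F (p + q.2 • q.1) := by
    have : Measurable fun q : E d × ℝ => F (p + q.2 • q.1) := hF.comp (by fun_prop)
    fun_prop
  rw [lintegral_lintegral_swap hmeas.aemeasurable]
  rw [setLIntegral_closedBall_eq, ← lintegral_mul_const _ (by fun_prop)]
  refine setLIntegral_mono' measurableSet_Ioc fun t ht => ?_
  have hm2 : Measurable fun x => F (p + x) := hF.comp (measurable_const_add p)
  rw [lintegral_const_mul _ (by fun_prop), mul_assoc]
  gcongr
  exact setLIntegral_closedBall_smul_le ht R (fun x => F (p + x)) hm2

/-- For `s > d / 2` a smooth function on a ball differs from its value at the centre, in `L²`, by a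
multiple of its derivatives of order `1, …, s`. -/
theorem exists_lintegral_sub_center_le (d s : ℕ) (hs : (d : ℝ) / 2 < s) :
    ∃ C : NNReal, ∀ (U : Opens (E d)) (u : 𝓓(U, ℝ)) (p : E d) (R : ℝ),
      ∫⁻ x in Metric.closedBall p R, ‖u x - u p‖ₑ ^ 2 ≤
        C * ∑ k ∈ Finset.Icc 1 s, ENNReal.ofReal R ^ (2 * k) *
          energy k u (Metric.closedBall p R) := by
  -- With remainder of order `n + 1 = s` the weight is `t ^ (n - d / 2)`, and `s > d / 2` says that
  -- the exponent exceeds `-1`.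
  obtain ⟨n, rfl⟩ : ∃ n, s = n + 1 := by
    refine Nat.exists_eq_succ_of_ne_zero fun h => ?_
    subst h
    exact absurd hs (not_lt.2 (by simp; positivity))
  have hm : -1 < (n : ℝ) - d / 2 := by push_cast at hs; linarith
  set I := ∫⁻ t in Set.Ioc (0 : ℝ) 1, ENNReal.ofReal (t ^ ((n : ℝ) - d / 2)) with hI
  have hIt : I ≠ ⊤ := lintegral_Ioc_rpow_ne_top hm
  set c : ℕ → ENNReal := fun k => d ^ (2 * k) * (level d k).card with hc
  have hct : ∀ k, c k ≠ ⊤ := fun k => by simp [hc, ENNReal.mul_eq_top]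
  set M := ∑ k ∈ Finset.Icc 1 (n + 1), c k with hM
  have hMt : M ≠ ⊤ := by simp [hM, ENNReal.sum_eq_top, hct]
  have hCt : 2 * (n + I * I) * M ≠ ⊤ :=
    ENNReal.mul_ne_top (ENNReal.mul_ne_top (by simp) (by simp [ENNReal.mul_eq_top, hIt])) hMt
  refine ⟨(2 * (n + I * I) * M).toNNReal, fun U u p R => ?_⟩
  rw [ENNReal.coe_toNNReal hCt]
  set S : ℕ → E d → ENNReal := fun k x => ∑ γ ∈ level d k, ‖partialD γ u x‖ₑ ^ 2 with hS
  have hSm : ∀ k, Measurable (S k) := fun k =>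
    Finset.measurable_fun_sum _ fun _ _ => measurable_enorm_test _
  set A : ℕ → ENNReal := fun k => ENNReal.ofReal R ^ (2 * k) *
    energy k u (Metric.closedBall p R) with hA
  have hcM : ∀ k ∈ Finset.Icc 1 (n + 1), c k ≤ M := fun k hk =>
    Finset.single_le_sum (fun _ _ => zero_le) hk
  have hen : ∀ k, ∫⁻ w in Metric.closedBall 0 R, S k (p + w) =
      energy k u (Metric.closedBall p R) := fun k => by
    rw [energy_eq, setLIntegral_closedBall_eq p]
  rw [setLIntegral_closedBall_eq]
  have hpt := setLIntegral_mono' (μ := volume) measurableSet_closedBall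
    (fun w (hw : w ∈ Metric.closedBall (0 : E d) R) =>
      enorm_sub_sq_le_taylor n u p w (mem_closedBall_zero_iff.1 hw))
  refine hpt.trans ?_
  have hSp : ∀ k, Measurable fun w => S k (p + w) := fun k => (hSm k).comp (measurable_const_add p)
  have hline := lintegral_lintegral_line_le ((n : ℝ) - d / 2) R
    (fun x => c (n + 1) * ENNReal.ofReal R ^ (2 * (n + 1)) * S (n + 1) x) ((hSm _).const_mul _) p
  rw [lintegral_const_mul _ (hSm _), ← energy_eq] at hline
  have hm1 : Measurable fun w => (n : ENNReal) * ∑ k ∈ Finset.Ico 1 (n + 1),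
      c k * ENNReal.ofReal R ^ (2 * k) * S k (p + w) :=
    (Finset.measurable_fun_sum _ fun k _ => (hSp k).const_mul _).const_mul _
  -- The integral `I` enters twice: once as the Cauchy–Schwarz factor and once from Tonelli along
  -- the segments.
  calc _ = 2 * ∫⁻ w in Metric.closedBall 0 R, (n * ∑ k ∈ Finset.Ico 1 (n + 1),
            c k * ENNReal.ofReal R ^ (2 * k) * S k (p + w) +
          I * ∫⁻ t in Set.Ioc (0 : ℝ) 1, ENNReal.ofReal (t ^ ((n : ℝ) - d / 2)) *
            ENNReal.ofReal t ^ d * (c (n + 1) * ENNReal.ofReal R ^ (2 * (n + 1)) *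
              S (n + 1) (p + t • w))) := lintegral_const_mul' _ _ (by simp)
    _ = 2 * (n * ∑ k ∈ Finset.Ico 1 (n + 1), c k * A k + I *
          ∫⁻ w in Metric.closedBall 0 R, ∫⁻ t in Set.Ioc (0 : ℝ) 1,
            ENNReal.ofReal (t ^ ((n : ℝ) - d / 2)) *
            ENNReal.ofReal t ^ d * (c (n + 1) * ENNReal.ofReal R ^ (2 * (n + 1)) *
              S (n + 1) (p + t • w))) := by
        rw [lintegral_add_left hm1, lintegral_const_mul' _ _ (by simp),
          lintegral_finsetSum _ (fun k _ => (hSp k).const_mul _), lintegral_const_mul' _ _ hIt]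
        congr 4
        refine funext fun k => ?_
        rw [lintegral_const_mul _ (hSp k), hen, mul_assoc]
    _ ≤ 2 * (n * ∑ k ∈ Finset.Icc 1 (n + 1), M * A k + I * (I * (M *
          ∑ k ∈ Finset.Icc 1 (n + 1), A k))) := by
        gcongr 2 * (n * ?_ + I * ?_)
        · refine (Finset.sum_le_sum fun k hk => ?_).trans
            (Finset.sum_le_sum_of_subset (f := fun k => M * A k) fun k hk => ?_)
          · refine mul_le_mul_left (hcM k ?_) _
            simp only [Finset.mem_Ico, Finset.mem_Icc] at hk ⊢; omega
          · simp only [Finset.mem_Ico, Finset.mem_Icc] at hk ⊢; omega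
        · refine hline.trans ?_
          rw [mul_assoc (c (n + 1))]
          have hmem : n + 1 ∈ Finset.Icc 1 (n + 1) := by simp
          gcongr
          · exact hcM _ hmem
          · exact Finset.single_le_sum (f := A) (fun _ _ => zero_le) hmem
    _ = _ := by rw [← Finset.mul_sum]; ring

theorem energy_zero (u : 𝓓(U, ℝ)) (B : Set (E d)) : energy 0 u B = ∫⁻ x in B, ‖u x‖ₑ ^ 2 := by
  have : level d 0 = {0} := by
    ext γ; simp [mem_level, funext_iff]
  simp [energy, this, partialD_zero]

theorem energy_partialD_le (t : ℕ) (γ : Fin d → ℕ) (u : 𝓓(U, ℝ)) (B : Set (E d)) :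
    energy t (partialD γ u) B ≤ energy (t + ∑ k, γ k) u B :=
  sum_level_partialD_le t γ u (fun w => ∫⁻ x in B, ‖w x‖ₑ ^ 2) fun _ => zero_le

/-! ### Local Sobolev inequality -/

/-- Average `|u(p)|² ≤ 2 (|u(x)|² + |u(x) - u(p)|²)` over the ball, whose volume is `R ^ d` times
that of the unit ball. -/
theorem exists_sq_center_le (d s : ℕ) (hs : (d : ℝ) / 2 < s) :
    ∃ C : NNReal, ∀ (U : Opens (E d)) (u : 𝓓(U, ℝ)) (p : E d) (R : ℝ), 0 ≤ R →
      ENNReal.ofReal R ^ d * ‖u p‖ₑ ^ 2 ≤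
        C * ∑ k ∈ Finset.range (s + 1), ENNReal.ofReal R ^ (2 * k) *
          energy k u (Metric.closedBall p R) := by
  obtain ⟨C, hC⟩ := exists_lintegral_sub_center_le d s hs
  set v : ENNReal := volume (Metric.ball (0 : E d) 1) with hv
  have hv0 : v ≠ 0 := (Metric.measure_ball_pos _ _ one_pos).ne'
  have hvt : v ≠ ⊤ := measure_ball_lt_top.ne
  have hct : v⁻¹ * (2 * (1 + C)) ≠ ⊤ :=
    ENNReal.mul_ne_top (ENNReal.inv_ne_top.2 hv0) (ENNReal.mul_ne_top (by simp) (by simp))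
  refine ⟨(v⁻¹ * (2 * (1 + C))).toNNReal, fun U u p R hR => ?_⟩
  rw [ENNReal.coe_toNNReal hct]
  set A : ℕ → ENNReal := fun k => ENNReal.ofReal R ^ (2 * k) *
    energy k u (Metric.closedBall p R) with hA
  have hvol : volume (Metric.closedBall p R) = ENNReal.ofReal R ^ d * v := by
    rw [Measure.addHaar_closedBall _ _ hR, ENNReal.ofReal_pow hR]
    simp [hv]
  have h1 : volume (Metric.closedBall p R) * ‖u p‖ₑ ^ 2 ≤
      2 * (A 0 + C * ∑ k ∈ Finset.Icc 1 s, A k) := by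
    calc volume (Metric.closedBall p R) * ‖u p‖ₑ ^ 2
        = ∫⁻ x in Metric.closedBall p R, ‖u p‖ₑ ^ 2 := by simp [mul_comm]
      _ ≤ ∫⁻ x in Metric.closedBall p R, 2 * (‖u x‖ₑ ^ 2 + ‖u x - u p‖ₑ ^ 2) := by
          refine lintegral_mono fun x => ?_
          refine le_trans ?_ (ennreal_add_sq_le _ _)
          gcongr
          calc ‖u p‖ₑ = ‖u x - (u x - u p)‖ₑ := by rw [sub_sub_cancel]
            _ ≤ _ := enorm_sub_le
      _ ≤ _ := by
          rw [lintegral_const_mul' _ _ (by simp), lintegral_add_left (measurable_enorm_test u)]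
          gcongr
          · simp [hA, energy_zero]
          · exact hC U u p R
  have h2 : A 0 + C * ∑ k ∈ Finset.Icc 1 s, A k ≤ (1 + C) * ∑ k ∈ Finset.range (s + 1), A k := by
    rw [add_mul, one_mul]
    gcongr
    · exact Finset.single_le_sum (f := A) (fun _ _ => zero_le) (by simp)
    · intro k hk; simp only [Finset.mem_Icc, Finset.mem_range] at hk ⊢; omega
  calc ENNReal.ofReal R ^ d * ‖u p‖ₑ ^ 2
      = v⁻¹ * (volume (Metric.closedBall p R) * ‖u p‖ₑ ^ 2) := by
        rw [hvol, mul_comm _ v, mul_assoc, ← mul_assoc v⁻¹, ENNReal.inv_mul_cancel hv0 hvt, one_mul]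
    _ ≤ v⁻¹ * (2 * ((1 + C) * ∑ k ∈ Finset.range (s + 1), A k)) := by
        exact mul_le_mul_right (h1.trans (mul_le_mul_right h2 _)) _
    _ = _ := by ring

/-- The local Sobolev inequality, for derivatives of order at most `J < s - d / 2`. -/
theorem exists_sq_partialD_center_le (d s J : ℕ) (hJ : (J : ℝ) < s - (d : ℝ) / 2) :
    ∃ C : NNReal, ∀ (U : Opens (E d)) (u : 𝓓(U, ℝ)) (p : E d) (R : ℝ), 0 ≤ R →
      ∀ γ ∈ multiIdx d J, ENNReal.ofReal R ^ (d + 2 * ∑ k, γ k) * ‖partialD γ u p‖ₑ ^ 2 ≤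
        C * ∑ k ∈ Finset.range (s + 1), ENNReal.ofReal R ^ (2 * k) *
          energy k u (Metric.closedBall p R) := by
  -- A derivative of order `j` leaves `s - j` orders to spend, and `s - j > d / 2` for `j ≤ J`. The
  -- constants for all such `j` are then summed into one.
  have hex : ∀ j : ℕ, ∃ C : NNReal, j ≤ J → ∀ (U : Opens (E d)) (u : 𝓓(U, ℝ)) (p : E d) (R : ℝ),
      0 ≤ R → ENNReal.ofReal R ^ d * ‖u p‖ₑ ^ 2 ≤
        C * ∑ k ∈ Finset.range (s - j + 1), ENNReal.ofReal R ^ (2 * k) *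
          energy k u (Metric.closedBall p R) := fun j => by
    by_cases hj : j ≤ J
    · have hj' : (j : ℝ) ≤ J := by exact_mod_cast hj
      have hjs : j ≤ s := by
        have : (0 : ℝ) ≤ d := by positivity
        have : (j : ℝ) ≤ s := by linarith
        exact_mod_cast this
      obtain ⟨C, hC⟩ := exists_sq_center_le d (s - j) (by rw [Nat.cast_sub hjs]; linarith)
      exact ⟨C, fun _ => hC⟩
    · exact ⟨0, fun h => absurd h hj⟩
  choose C hC using hex
  refine ⟨∑ j ∈ Finset.range (J + 1), C j, fun U u p R hR γ hγ => ?_⟩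
  set j := ∑ k, γ k with hj
  have hjJ : j ≤ J := mem_multiIdx.1 hγ
  have hjs : j ≤ s := by
    have : (0 : ℝ) ≤ d := by positivity
    have : (j : ℝ) ≤ J := by exact_mod_cast hjJ
    have : (j : ℝ) ≤ s := by linarith
    exact_mod_cast this
  have h := hC j hjJ U (partialD γ u) p R hR
  have hCj : (C j : ENNReal) ≤ ((∑ j ∈ Finset.range (J + 1), C j : NNReal) : ENNReal) := by
    exact_mod_cast Finset.single_le_sum (f := C) (fun _ _ => zero_le) (by simpa using by omega)
  set A : ℕ → ENNReal := fun k => ENNReal.ofReal R ^ (2 * k) *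
    energy k u (Metric.closedBall p R) with hA
  calc ENNReal.ofReal R ^ (d + 2 * j) * ‖partialD γ u p‖ₑ ^ 2
      = ENNReal.ofReal R ^ (2 * j) * (ENNReal.ofReal R ^ d * ‖partialD γ u p‖ₑ ^ 2) := by ring
    _ ≤ ENNReal.ofReal R ^ (2 * j) * (C j * ∑ k ∈ Finset.range (s - j + 1),
          ENNReal.ofReal R ^ (2 * k) * energy k (partialD γ u) (Metric.closedBall p R)) := by
        gcongr
    _ ≤ ENNReal.ofReal R ^ (2 * j) * (C j * ∑ k ∈ Finset.range (s - j + 1),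
          ENNReal.ofReal R ^ (2 * k) * energy (k + j) u (Metric.closedBall p R)) := by
        gcongr
        exact energy_partialD_le _ _ _ _
    _ = C j * ∑ k ∈ Finset.range (s - j + 1), A (k + j) := by
        rw [mul_left_comm, Finset.mul_sum]
        congr 1
        refine Finset.sum_congr rfl fun k _ => ?_
        simp only [hA]; ring
    _ ≤ (∑ j ∈ Finset.range (J + 1), C j : NNReal) * ∑ k ∈ Finset.range (s + 1), A k := by
        gcongr
        rw [Finset.range_eq_Ico, Finset.sum_Ico_add' A 0 (s - j + 1) j]
        refine Finset.sum_le_sum_of_subset fun k hk => ?_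
        simp only [Finset.mem_Ico, Finset.mem_range] at hk ⊢; omega

/-! ### Families of balls with bounded overlap -/

/-- Every point lies in at most `N` of the closed balls with centres `x i` and radius `R`. -/
def BoundedOverlap {Q : ℕ} (N : ℕ) (R : ℝ) (x : Fin Q → E d) : Prop :=
  ∀ y, Set.ncard {i | y ∈ Metric.closedBall (x i) R} ≤ N

theorem BoundedOverlap.sum_lintegral_le {Q N : ℕ} {R : ℝ} {x : Fin Q → E d}
    (h : BoundedOverlap N R x) (F : E d → ENNReal) (hF : Measurable F) :
    ∑ i, ∫⁻ y in Metric.closedBall (x i) R, F y ≤ N * ∫⁻ y, F y := by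
  classical
  simp_rw [← lintegral_indicator measurableSet_closedBall]
  rw [← lintegral_finsetSum _ fun i _ => hF.indicator measurableSet_closedBall,
    ← lintegral_const_mul _ hF]
  refine lintegral_mono fun y => ?_
  have hy : (Finset.univ.filter fun i => y ∈ Metric.closedBall (x i) R).card ≤ N := by
    rw [← Set.ncard_coe_finset, Finset.coe_filter]
    simpa using h y
  simp only [Set.indicator_apply]
  rw [← Finset.sum_filter, Finset.sum_const, nsmul_eq_mul]
  gcongr

theorem BoundedOverlap.sum_energy_le {Q N : ℕ} {R : ℝ} {x : Fin Q → E d}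
    (h : BoundedOverlap N R x) (t : ℕ) (u : 𝓓(U, ℝ)) :
    ∑ i, energy t u (Metric.closedBall (x i) R) ≤ N * energy t u Set.univ := by
  simp only [energy_eq, Measure.restrict_univ]
  exact h.sum_lintegral_le _ (Finset.measurable_fun_sum _ fun _ _ => measurable_enorm_test _)

/-- Disjointness is assumed for interiors of cells, while the balls lie in closures; regularity of
the cells bridges the two. -/
theorem IsCellPartition.ball_subset_interior {δ h : ℝ} {Q : ℕ} {τ : Fin Q → Set (E d)}
    {x : Fin Q → E d} (hP : IsCellPartition U δ h τ x) (i : Fin Q) :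
    Metric.ball (x i) (δ * h) ⊆ interior (τ i) :=
  interior_maximal ((interior_maximal (hP.ball_subset i) Metric.isOpen_ball).trans (hP.regular i))
    Metric.isOpen_ball

theorem exists_boundedOverlap (d : ℕ) {δ : ℝ} (hδ : 0 < δ) :
    ∃ N : ℕ, ∀ (U : Opens (E d)) (h : ℝ), 0 < h → ∀ (Q : ℕ) (τ : Fin Q → Set (E d))
      (x : Fin Q → E d), IsCellPartition U δ h τ x → BoundedOverlap N (h / δ) x := by
  -- Volume packing: the small balls of the indices counted at `y` are disjoint and lie in the ball
  -- of radius `h / δ + δ h` about `y`. Dividing volumes, `h` cancels.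
  refine ⟨⌊((1 / δ + δ) / δ) ^ d⌋₊, fun U h hh Q τ x hP y => Nat.le_floor ?_⟩
  classical
  set K : Finset (Fin Q) := Finset.univ.filter fun i => y ∈ Metric.closedBall (x i) (h / δ) with hK
  have hcard : Set.ncard {i | y ∈ Metric.closedBall (x i) (h / δ)} = K.card := by
    rw [Set.ncard_eq_toFinset_card']; congr 1; ext i; simp [hK]
  rw [hcard]
  have hdisj : (K : Set (Fin Q)).PairwiseDisjoint fun i => Metric.ball (x i) (δ * h) :=
    fun i _ j _ hij => (hP.disjoint hij).mono (hP.ball_subset_interior i)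
      (hP.ball_subset_interior j)
  have hsub : (⋃ i ∈ K, Metric.ball (x i) (δ * h)) ⊆ Metric.closedBall y (h / δ + δ * h) := by
    refine Set.iUnion₂_subset fun i hi z hz => ?_
    have hi' : dist y (x i) ≤ h / δ := by simpa [hK] using hi
    have hz' : dist z (x i) < δ * h := hz
    have := dist_triangle_right z y (x i)
    exact Metric.mem_closedBall.2 (by linarith)
  have hmeas := measure_mono (μ := volume) hsub
  rw [measure_biUnion_finset hdisj fun _ _ => measurableSet_ball] at hmeas
  have hδh : 0 < δ * h := mul_pos hδ hh
  simp only [Measure.addHaar_ball_of_pos volume _ hδh, finrank_euclideanSpace, Fintype.card_fin,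
    Finset.sum_const, nsmul_eq_mul] at hmeas
  rw [Measure.addHaar_closedBall volume _ (by positivity), finrank_euclideanSpace, Fintype.card_fin,
    ← mul_assoc, ENNReal.mul_le_mul_iff_left (Metric.measure_ball_pos _ _ one_pos).ne'
      measure_ball_lt_top.ne, ← ENNReal.ofReal_natCast, ← ENNReal.ofReal_mul (by positivity),
    ENNReal.ofReal_le_ofReal_iff (by positivity)] at hmeas
  rw [div_pow, le_div_iff₀ (by positivity)]
  refine le_of_mul_le_mul_right ?_ (pow_pos hh d)
  calc _ = (K.card : ℝ) * (δ * h) ^ d := by rw [mul_pow]; ring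
    _ ≤ _ := hmeas
    _ = _ := by rw [← mul_pow]; congr 1; field_simp

/-! ### Interpolation -/

/-- Induction on the top index. The bound at tolerance `1` controls `A (s - 1)` by `A 0` and `A s`;
inserted in the inequality at `s`, it gives a quadratic inequality for `A s`, whose solution is
bounded by `η * A 0` plus a multiple of `A (s + 1)`. This replaces `A s` in the bound at tolerance
`ε / 2`. -/
theorem exists_interpolation_of_sq_le {K : ℝ} (hK : 0 ≤ K) (s : ℕ) :
    ∀ ε > 0, ∃ C : ℝ, 0 ≤ C ∧ ∀ A : ℕ → ℝ, (∀ n, 0 ≤ A n) →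
      (∀ t, t + 2 ≤ s → A (t + 1) ^ 2 ≤ K * (A t * A (t + 2))) →
      ∀ t, 1 ≤ t → t ≤ s → A t ≤ ε * A 0 + C * A s := by
  induction s with
  | zero => exact fun ε _ => ⟨0, le_rfl, fun A _ _ t h1 h2 => by omega⟩
  | succ s ih =>
    intro ε hε
    obtain ⟨C1, hC1, h1⟩ := ih 1 one_pos
    obtain ⟨C3, hC3, h3⟩ := ih (ε / 2) (half_pos hε)
    -- Chosen so that the loss `C3 * η` uses up the other half of `ε`.
    set η : ℝ := ε / (2 * (C3 + 1)) with hη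
    have hη0 : 0 < η := by positivity
    have hηε : C3 * η ≤ ε / 2 := by
      rw [hη, mul_div_assoc', div_le_div_iff₀ (by positivity) (by positivity)]
      nlinarith
    have hηε' : η ≤ ε := by
      rw [hη, div_le_iff₀ (by positivity)]; nlinarith
    set C2 : ℝ := K / η + K * C1 with hC2
    have hC20 : 0 ≤ C2 := by positivity
    -- The summand `1` takes care of `t = s + 1`.
    refine ⟨C2 + C3 * C2 + 1, by positivity, fun A hA hAA t ht1 ht2 => ?_⟩
    have hA0 := hA 0
    have hAs := hA s
    have hAs1 := hA (s + 1)
    rcases Nat.lt_or_ge s 1 with hs0 | hs1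
    · obtain rfl : t = s + 1 := by omega
      nlinarith [mul_nonneg hε.le hA0, mul_nonneg hC20 hAs1, mul_nonneg (mul_nonneg hC3 hC20) hAs1]
    have hprev : A (s - 1) ≤ A 0 + C1 * A s := by
      rcases Nat.eq_or_lt_of_le hs1 with h | h
      · rw [← h]; simp only [Nat.sub_self]; nlinarith [hA 1]
      · simpa using h1 A hA (fun t ht => hAA t (by omega)) (s - 1) (by omega) (by omega)
    have hstep : A s ^ 2 ≤ K * (A (s - 1) * A (s + 1)) := by
      have := hAA (s - 1) (by omega)
      rwa [show s - 1 + 1 = s by omega, show s - 1 + 2 = s + 1 by omega] at this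
    have hmain : A s ≤ η * A 0 + C2 * A (s + 1) := by
      have hb : K * (A (s - 1) * A (s + 1)) ≤ K * ((A 0 + C1 * A s) * A (s + 1)) := by gcongr
      set b := A (s + 1)
      have hKη : K / η * η = K := div_mul_cancel₀ _ hη0.ne'
      have h0 : 0 ≤ η * A 0 + C2 * b := by positivity
      refine le_of_sq_le_sq ?_ h0
      have e1 : A s ^ 2 ≤ 2 * (K * A 0 * b) + (K * C1 * b) ^ 2 := by
        nlinarith [sq_nonneg (A s - K * C1 * b)]
      have e2 : (η * A 0 + C2 * b) ^ 2 = (η * A 0) ^ 2 + 2 * (K / η * η) * A 0 * b +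
          2 * (η * A 0) * (K * C1 * b) + (K / η * b) ^ 2 + 2 * (K / η * b) * (K * C1 * b) +
          (K * C1 * b) ^ 2 := by rw [hC2]; ring
      rw [e2, hKη]
      have : 0 ≤ 2 * (η * A 0) * (K * C1 * b) := by positivity
      have : 0 ≤ 2 * (K / η * b) * (K * C1 * b) := by positivity
      nlinarith [sq_nonneg (η * A 0), sq_nonneg (K / η * b)]
    rcases Nat.lt_or_ge t (s + 1) with ht | ht
    · have h := h3 A hA (fun t ht => hAA t (by omega)) t ht1 (by omega)
      have h' : C3 * A s ≤ C3 * (η * A 0 + C2 * A (s + 1)) := by gcongr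
      have h'' : C3 * η * A 0 ≤ ε / 2 * A 0 := by gcongr
      nlinarith [mul_nonneg hC20 hAs1]
    · obtain rfl : t = s + 1 := by omega
      nlinarith [mul_nonneg hε.le hA0, mul_nonneg hC20 hAs1, mul_nonneg (mul_nonneg hC3 hC20) hAs1]

/-- The energy `∑_{|γ| = t} ‖D^γ u‖²_{L²}`. -/
def testEnergy (t : ℕ) (u : 𝓓(U, ℝ)) : ℝ := ∑ γ ∈ level d t, ‖testToL2 U (partialD γ u)‖ ^ 2

theorem testEnergy_nonneg (t : ℕ) (u : 𝓓(U, ℝ)) : 0 ≤ testEnergy t u :=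
  Finset.sum_nonneg fun _ _ => sq_nonneg _

theorem enorm_testToL2_sq (u : 𝓓(U, ℝ)) : ‖testToL2 U u‖ₑ ^ 2 = ∫⁻ x, ‖u x‖ₑ ^ 2 := by
  change ‖(memLp_test u).toLp u‖ₑ ^ 2 = _
  rw [Lp.enorm_toLp, eLpNorm_eq_lintegral_rpow_enorm_toReal two_ne_zero ENNReal.ofNat_ne_top,
    ← ENNReal.rpow_natCast, ← ENNReal.rpow_mul]
  simp

theorem energy_univ (t : ℕ) (u : 𝓓(U, ℝ)) :
    energy t u Set.univ = ENNReal.ofReal (testEnergy t u) := by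
  rw [testEnergy, ENNReal.ofReal_sum_of_nonneg fun _ _ => sq_nonneg _, energy]
  refine Finset.sum_congr rfl fun γ _ => ?_
  rw [Measure.restrict_univ, ← enorm_testToL2_sq, ENNReal.ofReal_pow (norm_nonneg _),
    ofReal_norm]

theorem sobolevSeminorm_jet_sq {s t : ℕ} (ht : t ≤ s) (u : 𝓓(U, ℝ)) :
    sobolevSeminorm t (jet s U u) ^ 2 = testEnergy t u := by
  rw [sobolevSeminorm, Real.sq_sqrt (Finset.sum_nonneg fun _ _ => sq_nonneg _), testEnergy]
  refine Finset.sum_bij (fun γ _ => γ.1) (fun γ hγ => ?_) (fun γ _ γ' _ h => Subtype.ext h)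
    (fun γ hγ => ?_) fun γ _ => rfl
  · exact mem_level.2 (Finset.mem_filter.1 hγ).2
  · have h := mem_level.1 hγ
    exact ⟨⟨γ, mem_multiIdx.2 (h.trans_le ht)⟩, Finset.mem_filter.2 ⟨Finset.mem_univ _, h⟩, rfl⟩

theorem inner_testToL2 (u w : 𝓓(U, ℝ)) :
    inner ℝ (testToL2 U u) (testToL2 U w) = ∫ x, u x * w x := by
  rw [L2.inner_def]
  refine integral_congr_ae ?_
  filter_upwards [(memLp_test u).coeFn_toLp, (memLp_test w).coeFn_toLp] with x hu hw
  change inner ℝ (((memLp_test u).toLp u) x) (((memLp_test w).toLp w) x) = _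
  rw [hu, hw]
  simp [mul_comm]

/-- One integration by parts and Cauchy–Schwarz. -/
theorem norm_lineD_sq_le (v : E d) (u : 𝓓(U, ℝ)) :
    ‖testToL2 U (lineD v u)‖ ^ 2 ≤ ‖testToL2 U u‖ * ‖testToL2 U (lineD v (lineD v u))‖ := by
  rw [← real_inner_self_eq_norm_sq, inner_testToL2, integral_test_mul_lineD, ← inner_testToL2]
  refine (neg_le_abs _).trans ((abs_real_inner_le_norm _ _).trans (le_of_eq (mul_comm _ _)))

theorem norm_partialD_sq_le_testEnergy {t : ℕ} {γ : Fin d → ℕ} (hγ : γ ∈ level d t)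
    (u : 𝓓(U, ℝ)) : ‖testToL2 U (partialD γ u)‖ ^ 2 ≤ testEnergy t u :=
  Finset.single_le_sum (f := fun γ => ‖testToL2 U (partialD γ u)‖ ^ 2)
    (fun _ _ => sq_nonneg _) hγ

/-- Split one coordinate derivative off each `γ` and apply `norm_lineD_sq_le` to the remaining
derivative. -/
theorem testEnergy_succ_sq_le (t : ℕ) (u : 𝓓(U, ℝ)) :
    testEnergy (t + 1) u ^ 2 ≤
      (level d (t + 1)).card ^ 2 * (testEnergy t u * testEnergy (t + 2) u) := by
  have hterm : ∀ γ ∈ level d (t + 1), ‖testToL2 U (partialD γ u)‖ ^ 2 ≤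
      √(testEnergy t u * testEnergy (t + 2) u) := fun γ hγ => by
    obtain ⟨i, γ', hsplit, hγ'⟩ := exists_eq_single_add (mem_level.1 hγ)
    rw [hsplit, partialD_single_add]
    refine (norm_lineD_sq_le _ _).trans (Real.le_sqrt_of_sq_le ?_)
    rw [mul_pow, ← partialD_single_add, ← partialD_single_add]
    have h2 : Pi.single i 1 + (Pi.single i 1 + γ') ∈ level d (t + 2) := by
      simp [mem_level, Finset.sum_add_distrib, hγ']; omega
    exact mul_le_mul (norm_partialD_sq_le_testEnergy (mem_level.2 hγ') u)
      (norm_partialD_sq_le_testEnergy h2 u) (sq_nonneg _) (testEnergy_nonneg _ _)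
  have h := Finset.sum_le_card_nsmul _ _ _ hterm
  rw [nsmul_eq_mul] at h
  refine (pow_le_pow_left₀ (testEnergy_nonneg _ _) h 2).trans (le_of_eq ?_)
  rw [mul_pow, Real.sq_sqrt (mul_nonneg (testEnergy_nonneg _ _) (testEnergy_nonneg _ _))]

/-- The weights `R ^ (2 * t)` form a geometric sequence, so they preserve the log-convexity; the
constant is independent of `R`. -/
theorem exists_interpolation (d s : ℕ) {ε : ℝ} (hε : 0 < ε) :
    ∃ C : ℝ, 0 ≤ C ∧ ∀ (U : Opens (E d)) (u : 𝓓(U, ℝ)) (R : ℝ), ∀ t, 1 ≤ t → t ≤ s →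
      R ^ (2 * t) * testEnergy t u ≤
        ε * testEnergy 0 u + C * (R ^ (2 * s) * testEnergy s u) := by
  obtain ⟨C, hC, h⟩ := exists_interpolation_of_sq_le
    (K := ∑ t ∈ Finset.range (s + 1), ((level d t).card : ℝ) ^ 2)
    (Finset.sum_nonneg fun _ _ => sq_nonneg _) s ε hε
  refine ⟨C, hC, fun U u R t ht1 ht2 => ?_⟩
  have hn : ∀ t, 0 ≤ R ^ (2 * t) * testEnergy t u := fun t =>
    mul_nonneg ((even_two_mul t).pow_nonneg R) (testEnergy_nonneg _ _)
  simpa using h (fun t => R ^ (2 * t) * testEnergy t u) hn (fun t ht => by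
    have hcard : ((level d (t + 1)).card : ℝ) ^ 2 ≤
        ∑ t ∈ Finset.range (s + 1), ((level d t).card : ℝ) ^ 2 :=
      Finset.single_le_sum (f := fun t => ((level d t).card : ℝ) ^ 2) (fun _ _ => sq_nonneg _)
        (Finset.mem_range.2 (by omega))
    calc (R ^ (2 * (t + 1)) * testEnergy (t + 1) u) ^ 2
        = (R ^ (2 * (t + 1))) ^ 2 * testEnergy (t + 1) u ^ 2 := mul_pow _ _ _
      _ ≤ (R ^ (2 * (t + 1))) ^ 2 *
          ((level d (t + 1)).card ^ 2 * (testEnergy t u * testEnergy (t + 2) u)) := by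
          gcongr; exact testEnergy_succ_sq_le t u
      _ = (level d (t + 1)).card ^ 2 *
          ((R ^ (2 * t) * testEnergy t u) * (R ^ (2 * (t + 2)) * testEnergy (t + 2) u)) := by ring
      _ ≤ _ := mul_le_mul_of_nonneg_right hcard (mul_nonneg (hn _) (hn _))) t ht1 ht2

/-! ### Global estimates for test functions -/

theorem ofReal_pow_mul_enorm_sq {R : ℝ} (hR : 0 ≤ R) (n : ℕ) (a : ℝ) :
    ENNReal.ofReal R ^ n * ‖a‖ₑ ^ 2 = ENNReal.ofReal (R ^ n * a ^ 2) := by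
  rw [ENNReal.ofReal_mul (pow_nonneg hR _), ENNReal.ofReal_pow hR, ← sq_abs a,
    ENNReal.ofReal_pow (abs_nonneg _), Real.enorm_eq_ofReal_abs]

theorem ofReal_pow_mul_energy_univ {R : ℝ} (hR : 0 ≤ R) (n t : ℕ) (u : 𝓓(U, ℝ)) :
    ENNReal.ofReal R ^ n * energy t u Set.univ = ENNReal.ofReal (R ^ n * testEnergy t u) := by
  rw [energy_univ, ENNReal.ofReal_mul (pow_nonneg hR _), ENNReal.ofReal_pow hR]

theorem BoundedOverlap.sum_sum_energy_le {Q N : ℕ} {R : ℝ} (hR : 0 ≤ R) {x : Fin Q → E d}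
    (h : BoundedOverlap N R x) (C : NNReal) (I : Finset ℕ) (u : 𝓓(U, ℝ)) :
    ∑ i, C * ∑ k ∈ I, ENNReal.ofReal R ^ (2 * k) * energy k u (Metric.closedBall (x i) R) ≤
      ENNReal.ofReal (C * N * ∑ k ∈ I, R ^ (2 * k) * testEnergy k u) := by
  have hn : ∀ k ∈ I, 0 ≤ R ^ (2 * k) * testEnergy k u := fun k _ =>
    mul_nonneg (pow_nonneg hR _) (testEnergy_nonneg _ _)
  rw [ENNReal.ofReal_mul (by positivity), ENNReal.ofReal_mul (by positivity),
    ENNReal.ofReal_sum_of_nonneg hn, ENNReal.ofReal_natCast, ENNReal.ofReal_coe_nnreal,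
    ← Finset.mul_sum, Finset.sum_comm, mul_assoc, Finset.mul_sum I _ (N : ENNReal)]
  gcongr with k hk
  rw [← Finset.mul_sum, ← ofReal_pow_mul_energy_univ hR, mul_left_comm]
  gcongr
  exact h.sum_energy_le k u

/-- The Sobolev inequality at the centres of a family of balls with bounded overlap. -/
theorem exists_sum_sq_partialD_le (d s J N : ℕ) (hJ : (J : ℝ) < s - (d : ℝ) / 2) :
    ∃ C : ℝ, 0 ≤ C ∧ ∀ (U : Opens (E d)) (u : 𝓓(U, ℝ)) (R : ℝ), 0 ≤ R → ∀ (Q : ℕ)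
      (x : Fin Q → E d), BoundedOverlap N R x →
      ∑ i, ∑ γ ∈ multiIdx d J, R ^ (d + 2 * ∑ k, γ k) * partialD γ u (x i) ^ 2 ≤
        C * ∑ k ∈ Finset.range (s + 1), R ^ (2 * k) * testEnergy k u := by
  obtain ⟨C, hC⟩ := exists_sq_partialD_center_le d s J hJ
  refine ⟨((multiIdx d J).card * C : NNReal) * N, by positivity, fun U u R hR Q x hx => ?_⟩
  have hn : 0 ≤ ∑ k ∈ Finset.range (s + 1), R ^ (2 * k) * testEnergy k u :=
    Finset.sum_nonneg fun k _ => mul_nonneg (pow_nonneg hR _) (testEnergy_nonneg _ _)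
  rw [← ENNReal.ofReal_le_ofReal_iff (by positivity)]
  refine le_trans ?_ (hx.sum_sum_energy_le hR _ _ u)
  rw [ENNReal.ofReal_sum_of_nonneg fun i _ => Finset.sum_nonneg fun γ _ => by positivity]
  refine Finset.sum_le_sum fun i _ => ?_
  rw [ENNReal.ofReal_sum_of_nonneg fun γ _ => by positivity]
  refine (Finset.sum_le_card_nsmul _ _ (C * ∑ k ∈ Finset.range (s + 1), ENNReal.ofReal R ^ (2 * k) *
    energy k u (Metric.closedBall (x i) R)) fun γ hγ => ?_).trans (le_of_eq ?_)
  · rw [← ofReal_pow_mul_enorm_sq hR]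
    exact hC U u (x i) R hR γ hγ
  · rw [nsmul_eq_mul, ← mul_assoc]; simp

/-- A Poincaré inequality with one sampling point per ball of a covering family. -/
theorem exists_testEnergy_le (d s N : ℕ) (hs : (d : ℝ) / 2 < s) :
    ∃ C : ℝ, 0 ≤ C ∧ ∀ (U : Opens (E d)) (u : 𝓓(U, ℝ)) (R : ℝ), 0 ≤ R → ∀ (Q : ℕ)
      (x : Fin Q → E d), BoundedOverlap N R x → (U : Set (E d)) ⊆ ⋃ i, Metric.closedBall (x i) R →
      ∀ t ≤ s, R ^ (2 * t) * testEnergy t u ≤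
        C * (R ^ d * ∑ i, u (x i) ^ 2 + R ^ (2 * s) * testEnergy s u) := by
  obtain ⟨C₁, hC₁⟩ := exists_lintegral_sub_center_le d s hs
  set v : ℝ := (volume : Measure (E d)).real (Metric.ball (0 : E d) 1) with hv
  have hv0 : 0 ≤ v := measureReal_nonneg
  set C₀ : ℝ := 2 * (v + C₁ * N) with hC₀
  have hC₀0 : 0 ≤ C₀ := by positivity
  -- The tolerance makes the `s` intermediate orders, multiplied by `C₀`, contribute at most half of
  -- the energy of order `0`, which is moved to the left-hand side.
  obtain ⟨C₂, hC₂0, hC₂⟩ := exists_interpolation d s (ε := 1 / (2 * (C₀ + 1) * (s + 1)))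
    (by positivity)
  refine ⟨2 * C₀ + 2 * C₀ * s * C₂ + C₂, by positivity, fun U u R hR Q x hx hcov => ?_⟩
  have hE := fun t => testEnergy_nonneg t u
  set P := R ^ d * ∑ i, u (x i) ^ 2 with hP
  have hP0 : 0 ≤ P := by positivity
  have h0 : testEnergy 0 u ≤ C₀ * (P + ∑ k ∈ Finset.Icc 1 s, R ^ (2 * k) * testEnergy k u) := by
    have hn : 0 ≤ ∑ k ∈ Finset.Icc 1 s, R ^ (2 * k) * testEnergy k u :=
      Finset.sum_nonneg fun k _ => mul_nonneg (pow_nonneg hR _) (hE k)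
    rw [← ENNReal.ofReal_le_ofReal_iff (by positivity), ← energy_univ, energy_zero,
      Measure.restrict_univ]
    have hvol : ∀ i, volume (Metric.closedBall (x i) R) * ‖u (x i)‖ₑ ^ 2 =
        ENNReal.ofReal (v * (R ^ d * u (x i) ^ 2)) := fun i => by
      rw [Measure.addHaar_closedBall _ _ hR, ENNReal.ofReal_mul hv0, ← ofReal_pow_mul_enorm_sq hR,
        hv, ofReal_measureReal measure_ball_lt_top.ne, finrank_euclideanSpace, Fintype.card_fin,
        ENNReal.ofReal_pow hR]
      ring
    have hsupp : ∫⁻ y, ‖u y‖ₑ ^ 2 = ∫⁻ y in ⋃ i, Metric.closedBall (x i) R, ‖u y‖ₑ ^ 2 := by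
      rw [← lintegral_indicator (MeasurableSet.iUnion fun _ => measurableSet_closedBall)]
      refine lintegral_congr fun y => ?_
      by_cases hy : y ∈ ⋃ i, Metric.closedBall (x i) R
      · rw [Set.indicator_of_mem hy]
      · rw [Set.indicator_of_notMem hy,
          image_eq_zero_of_notMem_tsupport fun h => hy (hcov (u.tsupport_subset h))]
        simp
    rw [hsupp]
    calc ∫⁻ y in ⋃ i, Metric.closedBall (x i) R, ‖u y‖ₑ ^ 2
        ≤ ∑ i, ∫⁻ y in Metric.closedBall (x i) R, ‖u y‖ₑ ^ 2 := by
          refine (lintegral_iUnion_le _ _).trans (le_of_eq (tsum_fintype _))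
      _ ≤ ∑ i, 2 * (volume (Metric.closedBall (x i) R) * ‖u (x i)‖ₑ ^ 2 +
            C₁ * ∑ k ∈ Finset.Icc 1 s, ENNReal.ofReal R ^ (2 * k) *
              energy k u (Metric.closedBall (x i) R)) := by
          refine Finset.sum_le_sum fun i _ => ?_
          calc _ ≤ ∫⁻ y in Metric.closedBall (x i) R,
                2 * (‖u (x i)‖ₑ ^ 2 + ‖u y - u (x i)‖ₑ ^ 2) := by
                refine lintegral_mono fun y => le_trans ?_ (ennreal_add_sq_le _ _)
                gcongr
                calc ‖u y‖ₑ = ‖u (x i) + (u y - u (x i))‖ₑ := by rw [add_sub_cancel]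
                  _ ≤ _ := enorm_add_le _ _
            _ ≤ _ := by
                rw [lintegral_const_mul' _ _ (by simp), lintegral_add_left (by fun_prop),
                  lintegral_const, Measure.restrict_apply_univ, mul_comm (‖u (x i)‖ₑ ^ 2)]
                gcongr
                exact hC₁ U u (x i) R
      _ ≤ 2 * (ENNReal.ofReal (v * P) +
            ENNReal.ofReal (C₁ * N * ∑ k ∈ Finset.Icc 1 s, R ^ (2 * k) * testEnergy k u)) := by
          rw [← Finset.mul_sum, Finset.sum_add_distrib]
          gcongr
          · simp_rw [hvol]
            rw [← ENNReal.ofReal_sum_of_nonneg fun i _ => by positivity, hP, Finset.mul_sum,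
              Finset.mul_sum]
          · exact hx.sum_sum_energy_le hR C₁ _ u
      _ ≤ _ := by
          rw [← ENNReal.ofReal_add (by positivity) (by positivity), ← ENNReal.ofReal_ofNat 2,
            ← ENNReal.ofReal_mul (by norm_num)]
          refine ENNReal.ofReal_le_ofReal ?_
          have e1 : 0 ≤ C₁ * N * P := by positivity
          have e2 := mul_nonneg hv0 hn
          rw [hC₀]; nlinarith
  -- Interpolation is applied to the global energies only, after the sum over balls: on a single
  -- ball the integration by parts would have boundary terms.
  have hsum : ∑ k ∈ Finset.Icc 1 s, R ^ (2 * k) * testEnergy k u ≤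
      s * (1 / (2 * (C₀ + 1) * (s + 1)) * testEnergy 0 u +
        C₂ * (R ^ (2 * s) * testEnergy s u)) := by
    refine (Finset.sum_le_card_nsmul _ _ (1 / (2 * (C₀ + 1) * (s + 1)) * testEnergy 0 u +
      C₂ * (R ^ (2 * s) * testEnergy s u)) fun k hk => ?_).trans (le_of_eq ?_)
    · exact hC₂ U u R k (Finset.mem_Icc.1 hk).1 (Finset.mem_Icc.1 hk).2
    · rw [nsmul_eq_mul, Nat.card_Icc, Nat.add_sub_cancel]
  set Z := R ^ (2 * s) * testEnergy s u with hZ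
  have hZ0 : 0 ≤ Z := mul_nonneg (pow_nonneg hR _) (hE s)
  have h0' : testEnergy 0 u ≤ 2 * C₀ * P + 2 * C₀ * s * C₂ * Z := by
    have hcoef : C₀ * (s * (1 / (2 * (C₀ + 1) * (s + 1)))) ≤ 1 / 2 := by
      rw [mul_one_div, mul_div_assoc', div_le_div_iff₀ (by positivity) (by positivity)]
      have : (0 : ℝ) ≤ s := by positivity
      nlinarith [mul_nonneg hC₀0 this]
    have h1 := h0.trans (mul_le_mul_of_nonneg_left (add_le_add_right hsum P) hC₀0)
    have h2 := mul_le_mul_of_nonneg_right hcoef (hE 0)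
    nlinarith
  intro t ht
  have hfin : ∀ a, a ≤ testEnergy 0 u + C₂ * Z → a ≤ (2 * C₀ + 2 * C₀ * s * C₂ + C₂) * (P + Z) := by
    intro a ha
    have e1 : 0 ≤ 2 * C₀ * Z := by positivity
    have e2 : 0 ≤ 2 * C₀ * s * C₂ * P := by positivity
    have e3 : 0 ≤ C₂ * P := by positivity
    nlinarith
  refine hfin _ ?_
  rcases Nat.eq_zero_or_pos t with rfl | ht0
  · simpa using mul_nonneg hC₂0 hZ0
  · refine (hC₂ U u R t ht0 ht).trans ?_
    gcongr
    refine mul_le_of_le_one_left (hE 0) ?_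
    rw [div_le_one (by positivity)]
    have : (0 : ℝ) ≤ s := by positivity
    nlinarith [mul_nonneg hC₀0 this]

/-! ### Passage to `H_0^s` by density -/

theorem denseRange_toH0 (s : ℕ) (U : Opens (E d)) : DenseRange (toH0 s U) := by
  intro f
  rw [Metric.mem_closure_iff]
  intro ε hε
  have hf : (f : Jet d s) ∈ closure (Set.range (jet s U)) := f.2
  obtain ⟨_, ⟨u, rfl⟩, hu⟩ := Metric.mem_closure_iff.1 hf ε hε
  exact ⟨_, ⟨u, rfl⟩, hu⟩

/-- `toH0` as a linear map. -/
def toH0Lin (s : ℕ) (U : Opens (E d)) : 𝓓(U, ℝ) →ₗ[ℝ] H0 s U :=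
  (jet s U).codRestrict (H0 s U) (jet_mem_H0 s U)

theorem continuous_sobolevSeminorm {s : ℕ} (t : ℕ) :
    Continuous (sobolevSeminorm t : Jet d s → ℝ) := by
  unfold sobolevSeminorm
  fun_prop

theorem sobolevSeminorm_nonneg {s : ℕ} (t : ℕ) (f : Jet d s) : 0 ≤ sobolevSeminorm t f :=
  Real.sqrt_nonneg _

theorem norm_sq_eq_sum_sobolevSeminorm_sq {s : ℕ} (f : Jet d s) :
    ‖f‖ ^ 2 = ∑ t ∈ Finset.range (s + 1), sobolevSeminorm t f ^ 2 := by
  rw [PiLp.norm_sq_eq_of_L2]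
  simp only [sobolevSeminorm]
  simp_rw [Real.sq_sqrt (Finset.sum_nonneg fun _ _ => sq_nonneg _)]
  refine (Finset.sum_fiberwise_of_maps_to (fun γ _ => ?_) _).symm
  have := mem_multiIdx.1 γ.2
  exact Finset.mem_range.2 (by omega)

theorem norm_jet_sq (s : ℕ) (u : 𝓓(U, ℝ)) :
    ‖jet s U u‖ ^ 2 = ∑ t ∈ Finset.range (s + 1), testEnergy t u := by
  rw [norm_sq_eq_sum_sobolevSeminorm_sq]
  exact Finset.sum_congr rfl fun t ht =>
    sobolevSeminorm_jet_sq (Nat.lt_succ_iff.1 (Finset.mem_range.1 ht)) u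

/-- Makes the estimates for families of balls available for a single ball. -/
theorem boundedOverlap_of_subsingleton (R : ℝ) (x : Fin 1 → E d) : BoundedOverlap 1 R x :=
  fun _ => Set.ncard_le_one_of_subsingleton _

/-- Squaring turns the real exponent `d / 2 + |γ|` into a natural one. -/
theorem IsScaledDerivDirac.sq_apply {s : ℕ} {h : ℝ} (hh : 0 < h) {p : E d} {γ : Fin d → ℕ}
    {φ : Hneg s U} (hφ : IsScaledDerivDirac h p γ φ) (u : 𝓓(U, ℝ)) :
    φ (toH0 s U u) ^ 2 = h ^ (d + 2 * ∑ k, γ k) * partialD γ u p ^ 2 := by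
  rw [hφ u, mul_pow, ← Real.rpow_natCast (h ^ _), ← Real.rpow_mul hh.le, ← Real.rpow_natCast h]
  congr 2
  push_cast
  ring

/-- Scaled derivatives of order less than `s - d / 2` of Dirac functionals belong to `H^{-s}`. -/
theorem exists_isScaledDerivDirac {s J : ℕ} (hJ : (J : ℝ) < s - (d : ℝ) / 2) (U : Opens (E d))
    (h : ℝ) (p : E d) {γ : Fin d → ℕ} (hγ : ∑ k, γ k ≤ J) :
    ∃ φ : Hneg s U, IsScaledDerivDirac h p γ φ := by
  obtain ⟨C, hC0, hC⟩ := exists_sum_sq_partialD_le d s J 1 hJ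
  set c : ℝ := h ^ ((d : ℝ) / 2 + ∑ k, (γ k : ℝ)) with hc
  let L : 𝓓(U, ℝ) →ₗ[ℝ] ℝ :=
    { toFun := fun u => c * partialD γ u p
      map_add' := fun u w => by rw [map_add, ← mul_add]; rfl
      map_smul' := fun a u => by
        rw [map_smul]
        change c * (a * partialD γ u p) = a * (c * partialD γ u p)
        ring }
  have hL : ∀ u, ‖L u‖ ≤ |c| * √C * ‖toH0Lin s U u‖ := fun u => by
    -- One ball of radius `1`: all weights become `1`, and the right-hand side is the squared norm
    -- of the jet.
    have h1 := hC U u 1 zero_le_one 1 (fun _ => p) (boundedOverlap_of_subsingleton _ _)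
    simp only [one_pow, one_mul, Finset.univ_unique, Finset.sum_const, Finset.card_singleton,
      one_smul] at h1
    rw [← norm_jet_sq] at h1
    have h2 := (Finset.single_le_sum (f := fun γ => partialD γ u p ^ 2) (fun _ _ => sq_nonneg _)
      (mem_multiIdx.2 hγ)).trans h1
    have h3 : |partialD γ u p| ≤ √C * ‖jet s U u‖ := by
      rw [← Real.sqrt_sq (norm_nonneg (jet s U u)), ← Real.sqrt_mul hC0]
      exact Real.abs_le_sqrt h2
    change |c * partialD γ u p| ≤ |c| * √C * ‖jet s U u‖
    rw [abs_mul, mul_assoc]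
    gcongr
  refine ⟨L.extendOfNorm (toH0Lin s U), fun u => ?_⟩
  exact LinearMap.extendOfNorm_eq (denseRange_toH0 s U) ⟨_, hL⟩ u

theorem exists_notMem_of_isBounded (hd : 1 ≤ d) (hU : Bornology.IsBounded (U : Set (E d))) :
    ∃ p, p ∉ U := by
  have : Nonempty (Fin d) := ⟨⟨0, hd⟩⟩
  have : Nontrivial (E d) := inferInstance
  by_contra! h
  exact NormedSpace.unbounded_univ ℝ (E d) (hU.subset fun x _ => h x)

/-- Friedrichs' inequality. -/
theorem exists_norm_le_h0norm {s : ℕ} (hd : 1 ≤ d) (hs : (d : ℝ) / 2 < s)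
    (hU : Bornology.IsBounded (U : Set (E d))) :
    ∃ K : ℝ, 0 ≤ K ∧ ∀ f : H0 s U, ‖f‖ ≤ K * h0norm f.1 := by
  obtain ⟨C, hC0, hC⟩ := exists_testEnergy_le d s 1 hs
  -- A sampling point outside `U` contributes nothing, so the Poincaré inequality with one large
  -- ball keeps only the energy of order `s`.
  obtain ⟨p, hp⟩ := exists_notMem_of_isBounded hd hU
  obtain ⟨R₀, hR₀⟩ := hU.subset_closedBall p
  set R := max R₀ 1
  have hR : 0 < R := lt_max_of_lt_right one_pos
  have hUR : (U : Set (E d)) ⊆ Metric.closedBall p R :=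
    hR₀.trans (Metric.closedBall_subset_closedBall (le_max_left _ _))
  set K : ℝ := ∑ t ∈ Finset.range (s + 1), C * R ^ (2 * s) / R ^ (2 * t) with hK
  have hK0 : 0 ≤ K := by positivity
  refine ⟨√K, Real.sqrt_nonneg _, fun f => ?_⟩
  refine (denseRange_toH0 s U).induction_on (p := fun f : H0 s U => ‖f‖ ≤ √K * h0norm f.1) f
    (isClosed_le (by fun_prop)
      (((continuous_sobolevSeminorm s).comp continuous_subtype_val).const_mul _)) fun u => ?_
  have hu : u p = 0 := image_eq_zero_of_notMem_tsupport fun h => hp (u.tsupport_subset h)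
  have key : ‖jet s U u‖ ^ 2 ≤ K * testEnergy s u := by
    rw [norm_jet_sq, hK, Finset.sum_mul]
    refine Finset.sum_le_sum fun t ht => ?_
    have := hC U u R hR.le 1 (fun _ => p) (boundedOverlap_of_subsingleton _ _)
      (hUR.trans (Set.subset_iUnion (fun _ : Fin 1 => Metric.closedBall p R) 0)) t
      (Nat.lt_succ_iff.1 (Finset.mem_range.1 ht))
    simp only [hu, ne_eq, OfNat.ofNat_ne_zero, not_false_eq_true, zero_pow, Finset.sum_const_zero,
      mul_zero, zero_add] at this
    rw [div_mul_eq_mul_div, le_div_iff₀ (by positivity), mul_comm, mul_assoc]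
    exact this
  change ‖jet s U u‖ ≤ √K * sobolevSeminorm s (jet s U u)
  rw [← Real.sqrt_sq (sobolevSeminorm_nonneg s (jet s U u)), ← Real.sqrt_mul hK0,
    sobolevSeminorm_jet_sq le_rfl]
  exact Real.le_sqrt_of_sq_le key

theorem IsCellPartition.subset_iUnion_closedBall {δ h : ℝ} {Q : ℕ} {τ : Fin Q → Set (E d)}
    {x : Fin Q → E d} (hP : IsCellPartition U δ h τ x) :
    (U : Set (E d)) ⊆ ⋃ i, Metric.closedBall (x i) (h / δ) :=
  hP.cover.trans (Set.iUnion_mono hP.subset_ball)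

/-- The Poincaré inequality in `H_0^s`, with one sampling point per cell. -/
theorem exists_sobolevSeminorm_sq_le (d s : ℕ) (hs : (d : ℝ) / 2 < s) {δ : ℝ}
    (hδ : δ ∈ Set.Ioo (0 : ℝ) 1) :
    ∃ C : ℝ, 0 ≤ C ∧ ∀ (U : Opens (E d)) (h : ℝ), 0 < h → ∀ (Q : ℕ) (τ : Fin Q → Set (E d))
      (x : Fin Q → E d), IsCellPartition U δ h τ x → ∀ φ : Fin Q → Hneg s U,
      (∀ i, IsScaledDerivDirac h (x i) 0 (φ i)) → ∀ f : H0 s U, ∀ t ≤ s,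
      h ^ (2 * t) * sobolevSeminorm t f.1 ^ 2 ≤
        C * (∑ i, φ i f ^ 2 + h ^ (2 * s) * h0norm f.1 ^ 2) := by
  obtain ⟨N, hN⟩ := exists_boundedOverlap d hδ.1
  obtain ⟨C, hC0, hC⟩ := exists_testEnergy_le d s N hs
  have hδ0 := hδ.1
  -- The cost of passing from the covering radius `h / δ` back to `h`, in the sample term and in the
  -- top-order term.
  set D : ℝ := (δ⁻¹) ^ d + (δ⁻¹) ^ (2 * s) with hD
  refine ⟨C * D, by positivity, fun U h hh Q τ x hP φ hφ f t ht => ?_⟩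
  refine (denseRange_toH0 s U).induction_on (p := fun f : H0 s U =>
    h ^ (2 * t) * sobolevSeminorm t f.1 ^ 2 ≤
      C * D * (∑ i, φ i f ^ 2 + h ^ (2 * s) * h0norm f.1 ^ 2)) f ?_ fun u => ?_
  · have hc : ∀ t, Continuous fun f : H0 s U => sobolevSeminorm t f.1 := fun t =>
      (continuous_sobolevSeminorm t).comp continuous_subtype_val
    have hc' : Continuous fun f : H0 s U => h0norm f.1 := hc s
    exact isClosed_le (by fun_prop) (by fun_prop)
  · have h1 := hC U u (h / δ) (by positivity) Q x (hN U h hh Q τ x hP) hP.subset_iUnion_closedBall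
      t ht
    have hsum : ∑ i, φ i (toH0 s U u) ^ 2 = h ^ d * ∑ i, u (x i) ^ 2 := by
      rw [Finset.mul_sum]
      refine Finset.sum_congr rfl fun i _ => ?_
      rw [(hφ i).sq_apply hh]
      simp [partialD_zero]
    change h ^ (2 * t) * sobolevSeminorm t (jet s U u) ^ 2 ≤ C * D * (∑ i, φ i (toH0 s U u) ^ 2 +
      h ^ (2 * s) * sobolevSeminorm s (jet s U u) ^ 2)
    rw [sobolevSeminorm_jet_sq ht, sobolevSeminorm_jet_sq le_rfl, hsum]
    have hE := fun t => testEnergy_nonneg t u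
    have hEs := hE s
    have hEt := hE t
    have hle : h ≤ h / δ := by
      rw [le_div_iff₀ hδ0]; nlinarith [hδ.2]
    calc h ^ (2 * t) * testEnergy t u ≤ (h / δ) ^ (2 * t) * testEnergy t u := by gcongr
      _ ≤ _ := h1
      _ = C * ((δ⁻¹) ^ d * (h ^ d * ∑ i, u (x i) ^ 2) +
          (δ⁻¹) ^ (2 * s) * (h ^ (2 * s) * testEnergy s u)) := by
          rw [div_eq_mul_inv, mul_pow, mul_pow]; ring
      _ ≤ C * (D * (h ^ d * ∑ i, u (x i) ^ 2) + D * (h ^ (2 * s) * testEnergy s u)) := by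
          gcongr <;> rw [hD]
          · exact le_add_of_nonneg_right (by positivity)
          · exact le_add_of_nonneg_left (by positivity)
      _ = _ := by ring

/-- The upper bound for sampled derivatives in `H_0^s`. -/
theorem exists_sum_sq_apply_le (d s J : ℕ) (hJ : (J : ℝ) < s - (d : ℝ) / 2) {δ : ℝ}
    (hδ : δ ∈ Set.Ioo (0 : ℝ) 1) :
    ∃ C : ℝ, 0 ≤ C ∧ ∀ (U : Opens (E d)) (h : ℝ), 0 < h → ∀ (Q : ℕ) (τ : Fin Q → Set (E d))
      (x : Fin Q → E d), IsCellPartition U δ h τ x → ∀ (T : Fin Q → Type) [∀ i, Fintype (T i)]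
      (φ : ∀ i, T i → Hneg s U) (γ : ∀ i, T i → Fin d → ℕ), (∀ i, Function.Injective (γ i)) →
      (∀ i α, ∑ k, γ i α k ≤ J) → (∀ i α, IsScaledDerivDirac h (x i) (γ i α) (φ i α)) →
      UpperBoundCondition C h φ := by
  classical
  obtain ⟨N, hN⟩ := exists_boundedOverlap d hδ.1
  obtain ⟨C, hC0, hC⟩ := exists_sum_sq_partialD_le d s J N hJ
  have hδ0 := hδ.1
  refine ⟨C * (δ⁻¹) ^ (2 * s), by positivity, fun U h hh Q τ x hP T _ φ γ hinj hγ hφ f => ?_⟩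
  refine (denseRange_toH0 s U).induction_on (p := fun f : H0 s U =>
    ∑ i, ∑ α, φ i α f ^ 2 ≤ C * (δ⁻¹) ^ (2 * s) *
      ∑ t ∈ Finset.range (s + 1), h ^ (2 * t) * sobolevSeminorm t f.1 ^ 2) f ?_ fun u => ?_
  · have hc : ∀ t, Continuous fun f : H0 s U => sobolevSeminorm t f.1 := fun t =>
      (continuous_sobolevSeminorm t).comp continuous_subtype_val
    exact isClosed_le (by fun_prop) (by fun_prop)
  have hle : h ≤ h / δ := by
    rw [le_div_iff₀ hδ0]; nlinarith [hδ.2]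
  have h1 := hC U u (h / δ) (by positivity) Q x (hN U h hh Q τ x hP)
  -- Injectivity of `γ i` lets the sum over labels become a sum over distinct multi-indices, which
  -- is enlarged to all orders up to `J`; replacing `h` by `h / δ` only increases the weights.
  calc ∑ i, ∑ α, φ i α (toH0 s U u) ^ 2
      = ∑ i, ∑ η ∈ Finset.univ.image (γ i), h ^ (d + 2 * ∑ k, η k) * partialD η u (x i) ^ 2 := by
        refine Finset.sum_congr rfl fun i _ => ?_
        rw [Finset.sum_image ((hinj i).injOn)]
        exact Finset.sum_congr rfl fun α _ => (hφ i α).sq_apply hh u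
    _ ≤ ∑ i, ∑ η ∈ multiIdx d J, (h / δ) ^ (d + 2 * ∑ k, η k) * partialD η u (x i) ^ 2 := by
        refine Finset.sum_le_sum fun i _ => ?_
        refine (Finset.sum_le_sum_of_subset_of_nonneg (t := multiIdx d J) ?_
          fun η _ _ => by positivity).trans (Finset.sum_le_sum fun η _ => by gcongr)
        intro η hη
        obtain ⟨α, -, rfl⟩ := Finset.mem_image.1 hη
        exact mem_multiIdx.2 (hγ i α)
    _ ≤ _ := h1
    _ ≤ C * ∑ t ∈ Finset.range (s + 1), (δ⁻¹) ^ (2 * s) * (h ^ (2 * t) * testEnergy t u) := by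
        refine mul_le_mul_of_nonneg_left (Finset.sum_le_sum fun t ht => ?_) hC0
        have hEt := testEnergy_nonneg t u
        have ht' : t ≤ s := Nat.lt_succ_iff.1 (Finset.mem_range.1 ht)
        rw [div_eq_mul_inv, mul_pow, mul_comm (h ^ (2 * t)), mul_assoc]
        gcongr
        exact (one_le_inv₀ hδ0).2 hδ.2.le
    _ = _ := by
        rw [← Finset.mul_sum, ← mul_assoc]
        congr 1
        refine Finset.sum_congr rfl fun t ht => ?_
        rw [← sobolevSeminorm_jet_sq (Nat.lt_succ_iff.1 (Finset.mem_range.1 ht)) u]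
        rfl

/-- A real supremum over an unbounded set is `0` by convention, so boundedness is needed before any
term can be compared with `hnegNorm`. Friedrichs' inequality supplies it. -/
theorem bddAbove_hnegNorm {s : ℕ} (hd : 1 ≤ d) (hs : (d : ℝ) / 2 < s)
    (hU : Bornology.IsBounded (U : Set (E d))) (V : Opens (E d)) (φ : Hneg s U) :
    BddAbove (Set.range fun v : H0sub s U V => φ v.1 / h0norm v.1.1) := by
  obtain ⟨K, hK0, hK⟩ := exists_norm_le_h0norm hd hs hU
  refine ⟨‖φ‖ * K, ?_⟩
  rintro _ ⟨v, rfl⟩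
  refine div_le_of_le_mul₀ (sobolevSeminorm_nonneg _ _) (by positivity) ?_
  refine (le_abs_self _).trans ((φ.le_opNorm v.1).trans ?_)
  rw [mul_assoc]
  gcongr
  exact hK _

/-! ### Test functions with prescribed derivatives at a point -/

/-- If a map of test functions commutes with partial derivatives up to the factor `c`, then it
commutes with `D^γ` up to `c ^ |γ|`. -/
theorem partialD_map_of_lineD_map {c : ℝ} (T : 𝓓(V, ℝ) → 𝓓(U, ℝ))
    (hT : ∀ k u, lineD (EuclideanSpace.single k 1) (T u) =
      c • T (lineD (EuclideanSpace.single k 1) u)) (γ : Fin d → ℕ) (u : 𝓓(V, ℝ)) :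
    partialD γ (T u) = c ^ (∑ k, γ k) • T (partialD γ u) := by
  induction h : ∑ k, γ k generalizing γ with
  | zero =>
    obtain rfl : γ = 0 := by ext k; simpa using (Finset.sum_eq_zero_iff.1 h) k (Finset.mem_univ k)
    simp [partialD_zero]
  | succ n ih =>
    obtain ⟨i, γ', rfl, hγ'⟩ := exists_eq_single_add h
    rw [partialD_single_add, ih γ' hγ', partialD_single_add, LinearMap.map_smul, hT, smul_smul,
      pow_succ]

/-- The inclusion `C_c^∞(V) ⊆ C_c^∞(U)`. -/
def testMono (hVU : V ≤ U) (u : 𝓓(V, ℝ)) : 𝓓(U, ℝ) :=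
  ⟨u, u.contDiff, u.hasCompactSupport, u.tsupport_subset.trans hVU⟩

theorem partialD_testMono (hVU : V ≤ U) (γ : Fin d → ℕ) (u : 𝓓(V, ℝ)) :
    partialD γ (testMono hVU u) = testMono hVU (partialD γ u) := by
  have := partialD_map_of_lineD_map (c := 1) (testMono hVU) (fun k u => TestFunction.ext fun x => by
    rw [one_smul, lineD_apply]
    exact (lineD_apply _ u x).symm) γ u
  simpa using this

theorem jet_testMono (s : ℕ) (hVU : V ≤ U) (u : 𝓓(V, ℝ)) :
    jet s U (testMono hVU u) = jet s V u := by
  refine PiLp.ext fun γ => ?_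
  change testToL2 U (partialD γ.1 (testMono hVU u)) = testToL2 V (partialD γ.1 u)
  rw [partialD_testMono]
  rfl

/-- Multiplication of a test function by the coordinate `x_i`. -/
def coordMul (i : Fin d) (u : 𝓓(U, ℝ)) : 𝓓(U, ℝ) :=
  ⟨fun x => x i * u x, by
    have := u.contDiff
    exact ((EuclideanSpace.proj i : E d →L[ℝ] ℝ).contDiff).mul this,
    u.hasCompactSupport.mul_left,
    (tsupport_mul_subset_right).trans u.tsupport_subset⟩

theorem lineD_coordMul (v : E d) (i : Fin d) (u : 𝓓(U, ℝ)) :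
    lineD v (coordMul i u) = v i • u + coordMul i (lineD v u) := by
  refine TestFunction.ext fun x => ?_
  rw [lineD_apply]
  have h1 : HasFDerivAt (fun x : E d => x i) (EuclideanSpace.proj i : E d →L[ℝ] ℝ) x :=
    (EuclideanSpace.proj i : E d →L[ℝ] ℝ).hasFDerivAt
  have h2 := (h1.mul (differentiable_test u).differentiableAt.hasFDerivAt).fderiv
  change fderiv ℝ (fun x => x i * u x) x v = v i * u x + x i * lineD v u x
  rw [lineD_apply]
  erw [h2]
  simp
  ring

/-- Leibniz' rule for a linear factor. If `γ i = 0`, the truncated subtraction is harmless because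
its coefficient is zero. -/
theorem partialD_coordMul (γ : Fin d → ℕ) (i : Fin d) (u : 𝓓(U, ℝ)) :
    partialD γ (coordMul i u) =
      coordMul i (partialD γ u) + (γ i : ℝ) • partialD (γ - Pi.single i 1) u := by
  induction h : ∑ k, γ k generalizing γ with
  | zero =>
    obtain rfl : γ = 0 := by ext k; simpa using (Finset.sum_eq_zero_iff.1 h) k (Finset.mem_univ k)
    simp [partialD_zero]
  | succ n ih =>
    obtain ⟨k, γ', rfl, hγ'⟩ := exists_eq_single_add h
    rw [partialD_single_add, ih γ' hγ', map_add, lineD_coordMul, LinearMap.map_smul,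
      ← partialD_single_add, ← partialD_single_add]
    rcases eq_or_ne k i with rfl | hki
    · have e1 : (Pi.single k 1 + γ' - Pi.single k 1 : Fin d → ℕ) = γ' := by simp
      rw [e1]
      simp only [PiLp.single_apply, if_true, Pi.add_apply, Pi.single_eq_same, Nat.cast_add,
        Nat.cast_one, add_smul, one_smul]
      rcases Nat.eq_zero_or_pos (γ' k) with h0 | h0
      · simp [h0]; abel
      · have e2 : (Pi.single k 1 + (γ' - Pi.single k 1) : Fin d → ℕ) = γ' := by
          ext j
          rcases eq_or_ne j k with rfl | hj
          · simp; omega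
          · simp [hj]
        rw [e2]; abel
    · have e2 : (Pi.single k 1 + (γ' - Pi.single i 1) : Fin d → ℕ) =
          Pi.single k 1 + γ' - Pi.single i 1 := by
        ext j
        rcases eq_or_ne j i with rfl | hj
        · simp [hki.symm]
        · simp [hj]
      simp [hki.symm, e2]

theorem eventually_lineD_eq_zero {p : E d} {u : 𝓓(U, ℝ)} {c : ℝ} (hu : ∀ᶠ x in nhds p, u x = c)
    (v : E d) : ∀ᶠ x in nhds p, lineD v u x = 0 := by
  have hu' : (u : E d → ℝ) =ᶠ[nhds p] fun _ => c := hu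
  filter_upwards [hu'.fderiv (𝕜 := ℝ)] with x hx
  rw [lineD_apply, hx]
  simp

theorem eventually_partialD_eq_zero {p : E d} {u : 𝓓(U, ℝ)} {c : ℝ} (hu : ∀ᶠ x in nhds p, u x = c)
    {γ : Fin d → ℕ} (hγ : γ ≠ 0) : ∀ᶠ x in nhds p, partialD γ u x = 0 := by
  induction h : ∑ k, γ k generalizing γ with
  | zero =>
    exact absurd (by ext k; simpa using (Finset.sum_eq_zero_iff.1 h) k (Finset.mem_univ k)) hγ
  | succ n ih =>
    obtain ⟨k, γ', rfl, hγ'⟩ := exists_eq_single_add h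
    rw [partialD_single_add]
    rcases eq_or_ne γ' 0 with rfl | h0
    · simpa [partialD_zero] using eventually_lineD_eq_zero hu _
    · exact eventually_lineD_eq_zero (ih h0 hγ') _

/-- The function is `x^γ / γ!` times a cutoff equal to `1` near `0`. Induction on `|γ|` builds it,
multiplying by a coordinate and dividing by the new exponent. -/
theorem exists_test_partialD_eq {δ : ℝ} (hδ : 0 < δ) (γ : Fin d → ℕ) :
    ∃ ψ : 𝓓((⟨Metric.ball 0 δ, Metric.isOpen_ball⟩ : Opens (E d)), ℝ),
      ∀ γ', partialD γ' ψ 0 = if γ' = γ then 1 else 0 := by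
  classical
  induction h : ∑ k, γ k generalizing γ with
  | zero =>
    obtain rfl : γ = 0 := by ext k; simpa using (Finset.sum_eq_zero_iff.1 h) k (Finset.mem_univ k)
    let χ : ContDiffBump (0 : E d) := ⟨δ / 4, δ / 2, by positivity, by linarith⟩
    refine ⟨⟨χ, χ.contDiff, χ.hasCompactSupport, ?_⟩, fun γ' => ?_⟩
    · rw [χ.tsupport_eq]
      exact Metric.closedBall_subset_ball (half_lt_self hδ)
    · split_ifs with h0
      · subst h0
        rw [partialD_zero]
        exact χ.eventuallyEq_one.eq_of_nhds
      · exact (eventually_partialD_eq_zero (c := 1)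
          (show ∀ᶠ x in nhds (0 : E d), χ x = 1 from χ.eventuallyEq_one) h0).self_of_nhds
  | succ n ih =>
    obtain ⟨i, η, rfl, hη⟩ := exists_eq_single_add h
    obtain ⟨ψ, hψ⟩ := ih η hη
    refine ⟨((η i : ℝ) + 1)⁻¹ • coordMul i ψ, fun γ' => ?_⟩
    rw [LinearMap.map_smul, partialD_coordMul]
    change ((η i : ℝ) + 1)⁻¹ * ((0 : E d) i * partialD γ' ψ 0 +
      γ' i * partialD (γ' - Pi.single i 1) ψ 0) = _
    rw [PiLp.zero_apply, zero_mul, zero_add, hψ]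
    by_cases h1 : γ' = Pi.single i 1 + η
    · subst h1
      have hpos : (η i : ℝ) + 1 ≠ 0 := by positivity
      simp [add_comm (1 : ℝ), hpos]
    · rw [if_neg h1]
      rcases Nat.eq_zero_or_pos (γ' i) with h0 | h0
      · simp [h0]
      · rw [if_neg]
        · simp
        · rintro rfl
          refine h1 ?_
          ext j
          rcases eq_or_ne j i with rfl | hj
          · simp; omega
          · simp [hj]

/-- The rescaled test function `x ↦ ψ ((x - p) / h)`. -/
def rescale {δ h : ℝ} (hh : 0 < h) (p : E d) (hV : Metric.ball p (δ * h) ⊆ V)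
    (ψ : 𝓓((⟨Metric.ball 0 δ, Metric.isOpen_ball⟩ : Opens (E d)), ℝ)) : 𝓓(V, ℝ) :=
  ⟨fun x => ψ (h⁻¹ • (x - p)), ψ.contDiff.comp (by fun_prop), by
    exact ψ.hasCompactSupport.comp_homeomorph
      ((Homeomorph.subRight p).trans (Homeomorph.smulOfNeZero h⁻¹ (inv_ne_zero hh.ne'))), by
    intro x hx
    have hc : Continuous fun x : E d => h⁻¹ • (x - p) := by fun_prop
    have := ψ.tsupport_subset (tsupport_comp_subset_preimage ψ hc hx)
    refine hV ?_
    have h2 : ‖h⁻¹ • (x - p)‖ < δ := by simpa using this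
    rw [norm_smul, norm_inv, Real.norm_of_nonneg hh.le, inv_mul_lt_iff₀ hh] at h2
    rw [mem_ball_iff_norm, mul_comm]
    exact h2⟩

theorem partialD_rescale {δ h : ℝ} (hh : 0 < h) (p : E d) (hV : Metric.ball p (δ * h) ⊆ V)
    (ψ : 𝓓((⟨Metric.ball 0 δ, Metric.isOpen_ball⟩ : Opens (E d)), ℝ)) (γ : Fin d → ℕ) :
    partialD γ (rescale hh p hV ψ) = h⁻¹ ^ (∑ k, γ k) • rescale hh p hV (partialD γ ψ) := by
  refine partialD_map_of_lineD_map (rescale hh p hV) (fun k u => TestFunction.ext fun x => ?_) γ ψ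
  rw [lineD_apply]
  change fderiv ℝ (fun x => u (h⁻¹ • (x - p))) x _ =
    h⁻¹ * lineD (EuclideanSpace.single k 1) u (h⁻¹ • (x - p))
  rw [lineD_apply]
  have h1 : HasFDerivAt (fun x : E d => h⁻¹ • (x - p)) (h⁻¹ • ContinuousLinearMap.id ℝ (E d)) x :=
    ((hasFDerivAt_id x).sub_const p).const_smul h⁻¹
  have h2 : HasFDerivAt (fun x : E d => u (h⁻¹ • (x - p))) _ x :=
    ((differentiable_test u).differentiableAt.hasFDerivAt).comp x h1
  rw [h2.fderiv]
  simp

theorem norm_testToL2_rescale_sq {δ h : ℝ} (hh : 0 < h) (p : E d)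
    (hV : Metric.ball p (δ * h) ⊆ V)
    (ψ : 𝓓((⟨Metric.ball 0 δ, Metric.isOpen_ball⟩ : Opens (E d)), ℝ)) :
    ‖testToL2 V (rescale hh p hV ψ)‖ ^ 2 = h ^ d * ‖testToL2 _ ψ‖ ^ 2 := by
  have key : ∫⁻ x, ‖rescale hh p hV ψ x‖ₑ ^ 2 = ENNReal.ofReal (h ^ d) * ∫⁻ x, ‖ψ x‖ₑ ^ 2 := by
    change ∫⁻ x, ‖ψ (h⁻¹ • (x - p))‖ₑ ^ 2 = _
    rw [lintegral_sub_right_eq_self (fun x => ‖ψ (h⁻¹ • x)‖ₑ ^ 2) p,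
      ← lintegral_map (measurable_enorm_test ψ) (measurable_const_smul h⁻¹),
      Measure.map_addHaar_smul _ (inv_ne_zero hh.ne'), lintegral_smul_measure]
    simp [abs_of_pos hh]
  have hof : ∀ (W : Opens (E d)) (w : 𝓓(W, ℝ)), ENNReal.ofReal (‖testToL2 W w‖ ^ 2) =
      ∫⁻ x, ‖w x‖ₑ ^ 2 := fun W w => by
    rw [← enorm_testToL2_sq, ENNReal.ofReal_pow (norm_nonneg _), ofReal_norm]
  rw [← ENNReal.ofReal_eq_ofReal_iff (sq_nonneg _) (by positivity), hof, key,
    ENNReal.ofReal_mul (by positivity), hof]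

/-- Test functions near `p`, dual to the scaled derivatives of the Dirac functional at `p`. -/
theorem exists_dual_test (d s J : ℕ) {δ : ℝ} (hδ : 0 < δ) :
    ∃ K : ℝ, 0 ≤ K ∧ ∀ (V : Opens (E d)) (h : ℝ), 0 < h → ∀ p : E d,
      Metric.ball p (δ * h) ⊆ V → ∀ γ ∈ multiIdx d J, ∃ w : 𝓓(V, ℝ),
        (∀ γ' : Fin d → ℕ, h ^ ((d : ℝ) / 2 + ∑ k, (γ' k : ℝ)) * partialD γ' w p =
          if γ' = γ then 1 else 0) ∧
        h ^ (2 * s) * testEnergy s w ≤ K := by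
  choose ψ hψ using fun γ : Fin d → ℕ => exists_test_partialD_eq hδ γ
  refine ⟨∑ γ ∈ multiIdx d J, testEnergy s (ψ γ),
    Finset.sum_nonneg fun _ _ => testEnergy_nonneg _ _,
    -- The factor `h ^ (-d / 2)` normalizes the pairings and also cancels the Jacobian `h ^ d`,
    -- while `h ^ (2 * s)` cancels the scaling of the derivatives. The weighted energy is therefore
    -- that of the reference function.
    fun V h hh p hV γ hγ => ⟨h ^ (-((d : ℝ) / 2)) • rescale hh p hV (ψ γ), fun γ' => ?_, ?_⟩⟩
  · rw [LinearMap.map_smul, partialD_rescale]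
    change h ^ ((d : ℝ) / 2 + ∑ k, (γ' k : ℝ)) * (h ^ (-((d : ℝ) / 2)) * (h⁻¹ ^ (∑ k, γ' k) *
      partialD γ' (ψ γ) (h⁻¹ • (p - p)))) = _
    rw [sub_self, smul_zero, hψ, ← mul_assoc, ← mul_assoc, ← Real.rpow_add hh, inv_pow,
      ← Real.rpow_natCast, ← Real.rpow_neg hh.le, ← Real.rpow_add hh]
    push_cast
    rw [show (d : ℝ) / 2 + ∑ k, (γ' k : ℝ) + -((d : ℝ) / 2) + -∑ k, (γ' k : ℝ) = 0 by ring]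
    simp
  · have hterm : h ^ (2 * s) * testEnergy s (h ^ (-((d : ℝ) / 2)) • rescale hh p hV (ψ γ)) =
        testEnergy s (ψ γ) := by
      rw [testEnergy, testEnergy, Finset.mul_sum]
      refine Finset.sum_congr rfl fun η hη => ?_
      rw [LinearMap.map_smul, partialD_rescale, LinearMap.map_smul, LinearMap.map_smul, norm_smul,
        norm_smul, mul_pow, mul_pow, norm_testToL2_rescale_sq, mem_level.1 hη,
        Real.norm_of_nonneg (Real.rpow_nonneg hh.le _), Real.norm_of_nonneg (by positivity),
        ← Real.rpow_natCast (h ^ _), ← Real.rpow_mul hh.le]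
      have e : h ^ (-((d : ℝ) / 2) * ((2 : ℕ) : ℝ)) * h ^ d = 1 := by
        rw [← Real.rpow_natCast h d, ← Real.rpow_add hh]
        push_cast
        rw [show -((d : ℝ) / 2) * 2 + d = 0 by ring, Real.rpow_zero]
      have e' : h ^ (2 * s) * (h⁻¹ ^ s) ^ 2 = 1 := by
        rw [← pow_mul, mul_comm s 2, ← mul_pow, mul_inv_cancel₀ hh.ne', one_pow]
      calc _ = (h ^ (-((d : ℝ) / 2) * ((2 : ℕ) : ℝ)) * h ^ d) * (h ^ (2 * s) * (h⁻¹ ^ s) ^ 2) *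
            ‖testToL2 _ (partialD η (ψ γ))‖ ^ 2 := by ring
        _ = _ := by rw [e, e', one_mul, one_mul]
    rw [hterm]
    exact Finset.single_le_sum (f := fun γ => testEnergy s (ψ γ))
      (fun _ _ => testEnergy_nonneg _ _) hγ

/-! ### Lower bound by duality, and assembly of the three conditions -/

theorem toH0_testMono_mem_H0sub (s : ℕ) (hVU : V ≤ U) (u : 𝓓(V, ℝ)) :
    toH0 s U (testMono hVU u) ∈ H0sub s U V := by
  change jet s U (testMono hVU u) ∈ H0 s V
  rw [jet_testMono]
  exact jet_mem_H0 s V u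

theorem testEnergy_sum_smul_le {ι : Type*} (I : Finset ι) (t : ℕ) (y : ι → ℝ) (w : ι → 𝓓(V, ℝ)) :
    testEnergy t (∑ i ∈ I, y i • w i) ≤ I.card * ∑ i ∈ I, y i ^ 2 * testEnergy t (w i) := by
  have h : ∀ γ ∈ level d t, ‖testToL2 V (partialD γ (∑ i ∈ I, y i • w i))‖ ^ 2 ≤
      I.card * ∑ i ∈ I, y i ^ 2 * ‖testToL2 V (partialD γ (w i))‖ ^ 2 := fun γ _ => by
    rw [map_sum, map_sum]
    refine (pow_le_pow_left₀ (norm_nonneg _) (norm_sum_le _ _) 2).trans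
      ((sq_sum_le_card_mul_sum_sq).trans (le_of_eq ?_))
    congr 1
    refine Finset.sum_congr rfl fun i _ => ?_
    rw [LinearMap.map_smul, LinearMap.map_smul, norm_smul, mul_pow, Real.norm_eq_abs, sq_abs]
  refine (Finset.sum_le_sum h).trans (le_of_eq ?_)
  rw [← Finset.mul_sum, Finset.sum_comm]
  simp only [testEnergy, Finset.mul_sum]

theorem pow_mul_testEnergy_sum_smul_le {ι : Type*} [Fintype ι] {h K n : ℝ} (hh : 0 ≤ h)
    (hn : (Fintype.card ι : ℝ) ≤ n) (s : ℕ) (y : EuclideanSpace ℝ ι)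
    (w : ι → 𝓓(V, ℝ)) (hw : ∀ α, h ^ (2 * s) * testEnergy s (w α) ≤ K) :
    h ^ (2 * s) * testEnergy s (∑ α, y α • w α) ≤ n * K * ‖y‖ ^ 2 := by
  rw [EuclideanSpace.real_norm_sq_eq]
  calc h ^ (2 * s) * testEnergy s (∑ α, y α • w α)
      ≤ h ^ (2 * s) * (Fintype.card ι * ∑ α, y α ^ 2 * testEnergy s (w α)) :=
        mul_le_mul_of_nonneg_left (testEnergy_sum_smul_le Finset.univ s y w) (pow_nonneg hh _)
    _ = Fintype.card ι * ∑ α, y α ^ 2 * (h ^ (2 * s) * testEnergy s (w α)) := by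
        rw [mul_left_comm, Finset.mul_sum]
        exact congrArg _ (Finset.sum_congr rfl fun α _ => mul_left_comm _ _ _)
    _ ≤ n * ∑ α, y α ^ 2 * K :=
        mul_le_mul hn
          (Finset.sum_le_sum fun α _ => mul_le_mul_of_nonneg_left (hw α) (sq_nonneg _))
          (Finset.sum_nonneg fun α _ => mul_nonneg (sq_nonneg _)
            (mul_nonneg (pow_nonneg hh _) (testEnergy_nonneg _ _)))
          ((Nat.cast_nonneg _).trans hn)
    _ = _ := by rw [← Finset.sum_mul]; ring

theorem partialD_sum_smul_apply {ι : Type*} (I : Finset ι) (γ : Fin d → ℕ) (y : ι → ℝ)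
    (w : ι → 𝓓(V, ℝ)) (x : E d) :
    partialD γ (∑ i ∈ I, y i • w i) x = ∑ i ∈ I, y i * partialD γ (w i) x := by
  classical
  induction I using Finset.induction_on with
  | empty => simp
  | insert a I ha ih =>
    rw [Finset.sum_insert ha, Finset.sum_insert ha, map_add, LinearMap.map_smul, ← ih]; rfl

theorem IsScaledDerivDirac.unique {s : ℕ} {h : ℝ} {p : E d} {γ : Fin d → ℕ} {φ φ' : Hneg s U}
    (hφ : IsScaledDerivDirac h p γ φ) (hφ' : IsScaledDerivDirac h p γ φ') : φ = φ' :=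
  ContinuousLinearMap.coeFn_injective
    ((denseRange_toH0 s U).equalizer φ.continuous φ'.continuous
      (funext fun u => (hφ u).trans (hφ' u).symm))

theorem hnegNorm_nonneg {s : ℕ} {φ : Hneg s U}
    (hb : BddAbove (Set.range fun v : H0sub s U V => φ v.1 / h0norm v.1.1)) :
    0 ≤ hnegNorm V φ :=
  le_ciSup_of_le hb 0 (by simp)

/-- A single competitor `f` bounds the supremum from below by `a ^ 2 / h0norm f`. If `a ≠ 0`, this
quotient is genuine: `h0norm f = 0` would force `f = 0` by Friedrichs' inequality, hence `Φ f = 0`.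
-/
theorem le_mul_hnegNorm {s : ℕ} (hd : 1 ≤ d) (hs : (d : ℝ) / 2 < s)
    (hU : Bornology.IsBounded (U : Set (E d))) {h a m : ℝ} (hh : 0 < h) (ha : 0 ≤ a) (hm : 0 ≤ m)
    {Φ : Hneg s U} {f : H0 s U} (hf : f ∈ H0sub s U V) (hΦf : Φ f = a ^ 2)
    (hnorm : h ^ s * h0norm f.1 ≤ m * a) : a ≤ m * (h ^ s)⁻¹ * hnegNorm V Φ := by
  have hb := bddAbove_hnegNorm hd hs hU V Φ
  have hhs : 0 < h ^ s := pow_pos hh s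
  rcases eq_or_lt_of_le ha with hy | hy
  · rw [← hy]
    exact mul_nonneg (mul_nonneg hm (inv_nonneg.2 hhs.le)) (hnegNorm_nonneg hb)
  have hpos : 0 < h0norm f.1 := by
    refine (sobolevSeminorm_nonneg s f.1).lt_of_ne' fun h0 => ?_
    obtain ⟨F, -, hF⟩ := exists_norm_le_h0norm hd hs hU
    have hf0 : f = 0 := by
      have := hF f
      rw [show h0norm f.1 = 0 from h0, mul_zero] at this
      exact norm_le_zero_iff.1 this
    rw [hf0, map_zero] at hΦf
    exact (pow_pos hy 2).ne hΦf
  have hsup : a ^ 2 / h0norm f.1 ≤ hnegNorm V Φ := by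
    rw [← hΦf]
    exact le_ciSup hb ⟨f, hf⟩
  refine le_trans ?_ (mul_le_mul_of_nonneg_left hsup (mul_nonneg hm (inv_nonneg.2 hhs.le)))
  generalize h0norm f.1 = b at *
  calc a = (h ^ s)⁻¹ * (h ^ s * b) * a / b := by field_simp
    _ ≤ (h ^ s)⁻¹ * (m * a) * a / b := by gcongr
    _ = _ := by ring

theorem exists_lowerBoundCondition (d s J : ℕ) (hd : 1 ≤ d) (hs : (d : ℝ) / 2 < s) {δ : ℝ}
    (hδ : 0 < δ) :
    ∃ C : ℝ, 0 ≤ C ∧ ∀ U : Opens (E d), Bornology.IsBounded (U : Set (E d)) → ∀ h : ℝ, 0 < h →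
      ∀ (Q : ℕ) (τ : Fin Q → Set (E d)) (x : Fin Q → E d), IsCellPartition U δ h τ x →
      ∀ (T : Fin Q → Type) [∀ i, Fintype (T i)] (φ : ∀ i, T i → Hneg s U)
        (γ : ∀ i, T i → Fin d → ℕ), (∀ i, Function.Injective (γ i)) →
      (∀ i α, ∑ k, γ i α k ≤ J) → (∀ i α, IsScaledDerivDirac h (x i) (γ i α) (φ i α)) →
      LowerBoundCondition C h τ φ := by
  classical
  obtain ⟨K, hK0, hK⟩ := exists_dual_test d s J hδ
  -- The cardinality bounds the number of functionals in a cell and comes from Cauchy–Schwarz for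
  -- the sum of dual functions; `K` bounds each weighted energy.
  set M : ℝ := (multiIdx d J).card * K with hM
  refine ⟨√M, Real.sqrt_nonneg _, fun U hU h hh Q τ x hP T _ φ γ hinj hγ hφ i y => ?_⟩
  set V := Opens.interior (τ i) with hV
  have hVU : V ≤ U := interior_subset.trans (hP.subset i)
  set Φ : Hneg s U := ∑ α, y α • φ i α with hΦ
  choose w hw1 hw2 using fun α : T i => hK V h hh (x i) (hP.ball_subset_interior i) (γ i α)
    (mem_multiIdx.2 (hγ i α))
  set v : 𝓓(V, ℝ) := ∑ α, y α • w α with hv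
  set f : H0 s U := toH0 s U (testMono hVU v) with hf
  have hφf : ∀ α, φ i α f = y α := fun α => by
    rw [hf, hφ i α, partialD_testMono]
    change _ * partialD (γ i α) v (x i) = _
    rw [hv, partialD_sum_smul_apply, Finset.mul_sum]
    simp_rw [mul_left_comm _ (y _), hw1]
    simp [(hinj i).eq_iff]
  have hΦf : Φ f = ‖y‖ ^ 2 := by
    rw [hΦ, EuclideanSpace.real_norm_sq_eq]
    simp only [sum_apply, smul_apply, hφf, smul_eq_mul, sq]
  have hcard : (Fintype.card (T i) : ℝ) ≤ (multiIdx d J).card := by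
    rw [← Finset.card_univ, ← Finset.card_image_of_injective _ (hinj i)]
    refine Nat.cast_le.2 (Finset.card_le_card fun η hη => ?_)
    obtain ⟨α, -, rfl⟩ := Finset.mem_image.1 hη
    exact mem_multiIdx.2 (hγ i α)
  have hnorm : h ^ s * h0norm f.1 ≤ √M * ‖y‖ := by
    have h1 : (h ^ s * h0norm f.1) ^ 2 ≤ M * ‖y‖ ^ 2 := by
      have e : h0norm f.1 ^ 2 = testEnergy s v := by
        change sobolevSeminorm s (jet s U (testMono hVU v)) ^ 2 = _
        rw [jet_testMono, sobolevSeminorm_jet_sq le_rfl]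
      rw [mul_pow, e, ← pow_mul, mul_comm s 2]
      exact pow_mul_testEnergy_sum_smul_le hh.le hcard s y w hw2
    rw [← Real.sqrt_sq (norm_nonneg y), ← Real.sqrt_mul (by positivity)]
    exact Real.le_sqrt_of_sq_le h1
  exact le_mul_hnegNorm hd hs hU hh (norm_nonneg y) (Real.sqrt_nonneg M)
    (toH0_testMono_mem_H0sub s hVU v) hΦf hnorm

/-- The chosen samples vanish on `PhiPerp`; what remains is to cancel `h ^ (2 * t)` and take square
roots. -/
theorem poincareCondition_of_sq_le {s Q : ℕ} {T : Fin Q → Type} {C h : ℝ} (hC : 0 ≤ C)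
    (hh : 0 < h) {φ : ∀ i, T i → Hneg s U} (α : ∀ i, T i)
    (H : ∀ f : H0 s U, ∀ t ≤ s, h ^ (2 * t) * sobolevSeminorm t f.1 ^ 2 ≤
      C * (∑ i, φ i (α i) f ^ 2 + h ^ (2 * s) * h0norm f.1 ^ 2)) :
    PoincareCondition (√C) h φ := by
  intro t ht f hf
  have h1 := H f t ht
  have h0 : ∑ i, φ i (α i) f ^ 2 = 0 :=
    Finset.sum_eq_zero fun i _ => by rw [hf i (α i)]; simp
  rw [h0, zero_add] at h1
  have hn := sobolevSeminorm_nonneg s f.1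
  have hn' : 0 ≤ h0norm f.1 := hn
  refine le_of_sq_le_sq ?_ (by positivity)
  rw [mul_pow, mul_pow, Real.sq_sqrt hC]
  refine le_of_mul_le_mul_left (h1.trans (le_of_eq ?_)) (pow_pos hh (2 * t))
  have : h ^ (2 * s) = h ^ (2 * t) * (h ^ (s - t)) ^ 2 := by
    rw [← pow_mul, ← pow_add]; congr 1; omega
  rw [this]; ring

/-- Two labels with the same multi-index would carry the same functional, against linear
independence. -/
theorem IsMeasurementFamily.injective_of_isScaledDerivDirac {s Q : ℕ} {τ : Fin Q → Set (E d)}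
    {T : Fin Q → Type} {φ : ∀ i, T i → Hneg s U} (hφ : IsMeasurementFamily τ φ) {h : ℝ}
    {x : Fin Q → E d} {γ : ∀ i, T i → Fin d → ℕ}
    (hγ : ∀ i α, IsScaledDerivDirac h (x i) (γ i α) (φ i α)) (i : Fin Q) :
    Function.Injective (γ i) := by
  intro α β hαβ
  refine (hφ.linearIndependent i).injective ?_
  have h1 := hγ i α
  rw [hαβ] at h1
  simp only [h1.unique (hγ i β)]

end Gamblet

end

theorem mainTheorem4 (d s J : ℕ) (hd : 1 ≤ d) (hJ : (J : ℝ) < (s : ℝ) - (d : ℝ) / 2)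
    (δ : ℝ) (hδ : δ ∈ Set.Ioo (0 : ℝ) 1) :
    ∃ C₀ : ℝ, 0 < C₀ ∧
      ∀ (Ω : TopologicalSpace.Opens (Gamblet.E d)), Gamblet.IsBoundedLipschitzDomain Ω →
      ∀ (h : ℝ), 0 < h →
      ∀ (Q : ℕ) (τ : Fin Q → Set (Gamblet.E d)) (x : Fin Q → Gamblet.E d),
        Gamblet.IsCellPartition Ω δ h τ x →
        -- the scaled measurements are well-defined elements of the dual space
        (∀ (i : Fin Q) (γ : Fin d → ℕ), ∑ k, γ k ≤ J →
          ∃ φ : Gamblet.Hneg s Ω, Gamblet.IsScaledDerivDirac h (x i) γ φ) ∧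
        ∀ (T : Fin Q → Type) [∀ i, Fintype (T i)] (φ : ∀ i, T i → Gamblet.Hneg s Ω),
          Gamblet.IsMeasurementFamily τ φ →
          (∀ i, ∃ α, Gamblet.IsScaledDerivDirac h (x i) 0 (φ i α)) →
          (∀ i α, ∃ γ : Fin d → ℕ, ∑ k, γ k ≤ J ∧
            Gamblet.IsScaledDerivDirac h (x i) γ (φ i α)) →
          Gamblet.PoincareCondition C₀ h φ ∧
          Gamblet.UpperBoundCondition C₀ h φ ∧
          Gamblet.LowerBoundCondition C₀ h τ φ := by
  have hs : (d : ℝ) / 2 < s := by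
    have : (0 : ℝ) ≤ J := by positivity
    linarith
  obtain ⟨C₁, hC₁, H₁⟩ := Gamblet.exists_sobolevSeminorm_sq_le d s hs hδ
  obtain ⟨C₂, hC₂, H₂⟩ := Gamblet.exists_sum_sq_apply_le d s J hJ hδ
  obtain ⟨C₃, hC₃, H₃⟩ := Gamblet.exists_lowerBoundCondition d s J hd hs hδ.1
  -- The root appears because the Poincaré estimate was proved for squares; the `1` secures
  -- positivity.
  refine ⟨√C₁ + C₂ + C₃ + 1, by positivity, fun Ω hΩ h hh Q τ x hP =>
    ⟨fun i γ hγ => Gamblet.exists_isScaledDerivDirac hJ Ω h (x i) hγ, fun T _ φ hφ h0 hγ => ?_⟩⟩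
  choose α₀ hα₀ using h0
  choose γ hγJ hγ using hγ
  have hinj := hφ.injective_of_isScaledDerivDirac hγ
  have hsq := Real.sqrt_nonneg C₁
  refine ⟨fun t ht f hf => ?_, fun f => ?_, fun i y => ?_⟩
  · refine (Gamblet.poincareCondition_of_sq_le hC₁ hh α₀
      (H₁ Ω h hh Q τ x hP (fun i => φ i (α₀ i)) hα₀) t ht f hf).trans ?_
    have : 0 ≤ Gamblet.h0norm f.1 := Gamblet.sobolevSeminorm_nonneg _ _
    gcongr
    linarith
  · refine (H₂ Ω h hh Q τ x hP T φ γ hinj hγJ hγ f).trans ?_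
    refine mul_le_mul_of_nonneg_right (by linarith) ?_
    exact Finset.sum_nonneg fun t _ => mul_nonneg (pow_nonneg hh.le _) (sq_nonneg _)
  · refine (H₃ Ω hΩ.bounded h hh Q τ x hP T φ γ hinj hγJ hγ i y).trans ?_
    have := Gamblet.hnegNorm_nonneg (Gamblet.bddAbove_hnegNorm hd hs hΩ.bounded
      (TopologicalSpace.Opens.interior (τ i)) (∑ α, y α • φ i α))
    gcongr
    linarith
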